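/- Let $\mathcal{C}$ be the Cesàro operator on the complex Hilbert space $L^2(\mathbb{R})$, $(\mathcal{C}f)(x)=\int_0^1 f(ux)\,du=\frac1x\int_0^x f(t)\,dt$. For $\alpha\in\mathbb{C}$ with $\mathrm{Re}(\alpha)>0$ let $H_\alpha$ be the Hölder mean operator of order $\alpha$, $$(H_\alpha f)(x)=\frac1{\Gamma(\alpha)}\int_0^1\Big(\log\frac1u\Big)^{\alpha-1}f(ux)\,du,$$ a bounded operator on $L^2(\mathbb{R})$, and put $H_0:=I$. An operator $B$ is called a holomorphic function of $\mathcal{C}$ if $B=F(\mathcal{C})$ for some function $F$ holomorphic in a neighborhood $N$ of the spectrum $\sigma(\mathcal{C})$ (the circle $|z-1|=1$), where $$F(\mathcal{C})=\frac1{2\pi i}\int_\Gamma F(z)(zI-\mathcal{C})^{-1}\,dz$$ and $\Gamma$ is the positively oriented boundary of an annulus $\{r<|z-1|<R\}$, $0<r<R$, that contains $\sigma(\mathcal{C})$ and whose closure is contained in $N$. Let $\mathrm{Re}(\alpha)>0$ or $\alpha=0$. Then $H_\alpha$ is a holomorphic function of $\mathcal{C}$ if and only if $\alpha$ is a nonnegative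 integer. Moreover, if $\mathrm{Re}(\alpha)>0$, then $H_\alpha=F(\mathcal{C})$ for some $F$ as above with $F(0)=0$ if and only if $\alpha$ is a (necessarily positive) integer. -/

import Mathlib

open MeasureTheory Set

/-- The Hilbert space `L²(ℝ)` of complex-valued functions. -/
abbrev L2R : Type := Lp ℂ 2 (volume : Measure ℝ)

/-- The boundedness condition `K(u)|u|^{-1/2} ∈ L¹(ℝ)` on the kernel of a Hausdorff operator. -/
def HausdorffKernel (K : ℝ → ℂ) : Prop :=
  Integrable (fun u : ℝ => K u * ((|u| ^ (-(1 / 2) : ℝ) : ℝ) : ℂ)) volume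

/-- The formula `x ↦ ∫ K(u) f(ux) du` for a Hausdorff operator. -/
noncomputable def hausdorffFun (K : ℝ → ℂ) (f : ℝ → ℂ) (x : ℝ) : ℂ :=
  ∫ u : ℝ, K u * f (u * x)

lemma HausdorffKernel.aestronglyMeasurable {K : ℝ → ℂ} (hK : HausdorffKernel K) :
    AEStronglyMeasurable K volume := by
  have h1 : AEStronglyMeasurable (fun u : ℝ => ((|u| ^ (1 / 2 : ℝ) : ℝ) : ℂ)) volume := by
    apply Measurable.aestronglyMeasurable
    fun_prop
  refine ((Integrable.aestronglyMeasurable hK).mul h1).congr ?_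
  filter_upwards [Measure.ae_ne volume (0 : ℝ)] with u hu
  have : 0 < |u| := abs_pos.mpr hu
  simp only [Pi.mul_apply]
  rw [mul_assoc, ← Complex.ofReal_mul, ← Real.rpow_add this]
  simp

lemma HausdorffKernel.lintegral_lt_top {K : ℝ → ℂ} (hK : HausdorffKernel K) :
    ∫⁻ u, ‖K u‖ₑ * ENNReal.ofReal (|u| ^ (-(1 / 2) : ℝ)) < ⊤ := by
  have := hK.hasFiniteIntegral
  rw [hasFiniteIntegral_iff_enorm] at this
  convert this using 3 with u
  rw [enorm_mul, ← ofReal_norm (((|u| ^ (-(1 / 2) : ℝ) : ℝ) : ℂ)), Complex.norm_real,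
    Real.norm_of_nonneg (by positivity)]

lemma lintegral_dilate {g : ℝ → ENNReal} (hg : Measurable g) {u : ℝ} (hu : u ≠ 0) :
    ∫⁻ x, g (u * x) = ENNReal.ofReal |u|⁻¹ * ∫⁻ x, g x := by
  have := Real.map_volume_mul_left hu
  rw [← lintegral_map hg (measurable_const_mul u), this, lintegral_smul_measure, abs_inv, smul_eq_mul]

lemma hausdorff_minkowski {K : ℝ → ℂ} (hK : HausdorffKernel K) {f : ℝ → ℂ}
    (hf : StronglyMeasurable f) :
    ∫⁻ x, (∫⁻ u, ‖K u‖ₑ * ‖f (u * x)‖ₑ) ^ (2 : ℝ) ≤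
      (∫⁻ u, ‖K u‖ₑ * ENNReal.ofReal (|u| ^ (-(1 / 2) : ℝ))) ^ (2 : ℝ) *
        ∫⁻ x, ‖f x‖ₑ ^ (2 : ℝ) := by
  set w : ℝ → ENNReal := fun u => ENNReal.ofReal (|u| ^ (-(1 / 2) : ℝ)) with hw
  set v : ℝ → ENNReal := fun u => ENNReal.ofReal (|u| ^ (1 / 2 : ℝ)) with hv
  have hwm : Measurable w := by fun_prop
  have hvm : Measurable v := by fun_prop
  have hk : AEMeasurable (fun u => ‖K u‖ₑ) volume := hK.aestronglyMeasurable.enorm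
  have hfm : Measurable f := hf.measurable
  set M := ∫⁻ u, ‖K u‖ₑ * w u with hM
  have hwv : ∀ u : ℝ, u ≠ 0 → w u * v u = 1 := by
    intro u hu
    have : 0 < |u| := abs_pos.mpr hu
    simp only [hw, hv]
    rw [← ENNReal.ofReal_mul (by positivity), ← Real.rpow_add this]
    simp
  have hvw : ∀ u : ℝ, u ≠ 0 → v u * ENNReal.ofReal |u|⁻¹ = w u := by
    intro u hu
    have : 0 < |u| := abs_pos.mpr hu
    simp only [hw, hv]
    rw [← ENNReal.ofReal_mul (by positivity), ← Real.rpow_neg_one, ← Real.rpow_add this]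
    norm_num
  have h1 : ∀ x : ℝ, (∫⁻ u, ‖K u‖ₑ * ‖f (u * x)‖ₑ) ^ (2 : ℝ) ≤
      M * ∫⁻ u, ‖K u‖ₑ * v u * ‖f (u * x)‖ₑ ^ (2 : ℝ) := by
    intro x
    have hH := ENNReal.lintegral_mul_le_Lp_mul_Lq (volume : Measure ℝ) Real.HolderConjugate.two_two
      (f := fun u => (‖K u‖ₑ * w u) ^ (1 / 2 : ℝ))
      (g := fun u => (‖K u‖ₑ * v u * ‖f (u * x)‖ₑ ^ (2 : ℝ)) ^ (1 / 2 : ℝ))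
      (by fun_prop) (by fun_prop)
    have e1 : ∀ a : ENNReal, (a ^ (1 / 2 : ℝ)) ^ (2 : ℝ) = a := by
      intro a; rw [← ENNReal.rpow_mul]; norm_num
    simp only [e1] at hH
    have e2 : ∫⁻ u, ‖K u‖ₑ * ‖f (u * x)‖ₑ = ∫⁻ u, ((fun u => (‖K u‖ₑ * w u) ^ (1 / 2 : ℝ)) *
        fun u => (‖K u‖ₑ * v u * ‖f (u * x)‖ₑ ^ (2 : ℝ)) ^ (1 / 2 : ℝ)) u := by
      apply lintegral_congr_ae
      filter_upwards [Measure.ae_ne volume (0 : ℝ)] with u hu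
      simp only [Pi.mul_apply]
      rw [← ENNReal.mul_rpow_of_nonneg _ _ (by norm_num)]
      have : ‖K u‖ₑ * w u * (‖K u‖ₑ * v u * ‖f (u * x)‖ₑ ^ (2 : ℝ)) =
          (‖K u‖ₑ * ‖f (u * x)‖ₑ) ^ (2 : ℝ) := by
        rw [ENNReal.mul_rpow_of_nonneg _ _ (by norm_num)]
        calc _ = (w u * v u) * (‖K u‖ₑ * ‖K u‖ₑ) * ‖f (u * x)‖ₑ ^ (2 : ℝ) := by ring
          _ = _ := by rw [hwv u hu, one_mul, ← sq, ← ENNReal.rpow_two]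
      rw [this, ← ENNReal.rpow_mul]
      norm_num
    rw [e2]
    calc _ ≤ _ := ENNReal.rpow_le_rpow hH (by norm_num)
      _ = _ := by rw [ENNReal.mul_rpow_of_nonneg _ _ (by norm_num), e1, e1]
  have hMtop : M ≠ ⊤ := hK.lintegral_lt_top.ne
  have hjm : AEMeasurable (Function.uncurry fun x u : ℝ =>
      ‖K u‖ₑ * v u * ‖f (u * x)‖ₑ ^ (2 : ℝ)) ((volume : Measure ℝ).prod volume) := by
    have : AEMeasurable (fun p : ℝ × ℝ => ‖K p.2‖ₑ) ((volume : Measure ℝ).prod volume) :=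
      hk.comp_quasiMeasurePreserving Measure.quasiMeasurePreserving_snd
    unfold Function.uncurry
    fun_prop
  calc ∫⁻ x, (∫⁻ u, ‖K u‖ₑ * ‖f (u * x)‖ₑ) ^ (2 : ℝ)
      ≤ ∫⁻ x, M * ∫⁻ u, ‖K u‖ₑ * v u * ‖f (u * x)‖ₑ ^ (2 : ℝ) := lintegral_mono h1
    _ = M * ∫⁻ x, ∫⁻ u, ‖K u‖ₑ * v u * ‖f (u * x)‖ₑ ^ (2 : ℝ) := lintegral_const_mul' _ _ hMtop
    _ = M * ∫⁻ u, ∫⁻ x, ‖K u‖ₑ * v u * ‖f (u * x)‖ₑ ^ (2 : ℝ) := by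
        rw [lintegral_lintegral_swap hjm]
    _ = M * ∫⁻ u, ‖K u‖ₑ * w u * ∫⁻ x, ‖f x‖ₑ ^ (2 : ℝ) := by
        congr 1
        apply lintegral_congr_ae
        filter_upwards [Measure.ae_ne volume (0 : ℝ)] with u hu
        rw [lintegral_const_mul _ (by fun_prop),
          lintegral_dilate (g := fun x => ‖f x‖ₑ ^ (2 : ℝ)) (by fun_prop) hu, ← hvw u hu]
        ring
    _ = _ := by
        rw [lintegral_mul_const'' _ (by fun_prop), ← hM, ENNReal.rpow_two]
        ring

/-- The constant `∫ |K(u)| |u|^{-1/2} du`, a bound for the norm of the Hausdorff operator. -/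
noncomputable def hausdorffBound (K : ℝ → ℂ) : ENNReal :=
  ∫⁻ u, ‖K u‖ₑ * ENNReal.ofReal (|u| ^ (-(1 / 2) : ℝ))

lemma lintegral_sq_L2 (f : L2R) : ∫⁻ x, ‖f x‖ₑ ^ (2 : ℝ) = ‖f‖ₑ ^ (2 : ℝ) := by
  rw [Lp.enorm_def, eLpNorm_eq_lintegral_rpow_enorm_toReal (by simp) (by simp), ← ENNReal.rpow_mul]
  simp

lemma hausdorff_aestronglyMeasurable {K : ℝ → ℂ} (hK : HausdorffKernel K) {f : ℝ → ℂ}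
    (hf : StronglyMeasurable f) :
    AEStronglyMeasurable (fun p : ℝ × ℝ => K p.2 * f (p.2 * p.1))
      ((volume : Measure ℝ).prod volume) := by
  have h1 : AEStronglyMeasurable (fun p : ℝ × ℝ => K p.2) ((volume : Measure ℝ).prod volume) :=
    hK.aestronglyMeasurable.comp_quasiMeasurePreserving Measure.quasiMeasurePreserving_snd
  exact h1.mul (hf.comp_measurable (by fun_prop)).aestronglyMeasurable

/-- For `f ∈ L²(ℝ)` the integral `∫ K(u) f(ux) du` converges absolutely for almost every `x`. -/
lemma hausdorff_ae_integrable {K : ℝ → ℂ} (hK : HausdorffKernel K) (f : L2R) :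
    ∀ᵐ x : ℝ, Integrable (fun u : ℝ => K u * f (u * x)) volume := by
  have hf := Lp.stronglyMeasurable f
  have h := hausdorff_minkowski hK hf
  rw [lintegral_sq_L2] at h
  have hfin : ∫⁻ x, (∫⁻ u, ‖K u‖ₑ * ‖f (u * x)‖ₑ) ^ (2 : ℝ) ≠ ⊤ := by
    refine ne_top_of_le_ne_top ?_ h
    exact ENNReal.mul_ne_top (ENNReal.rpow_ne_top_of_nonneg (by norm_num) hK.lintegral_lt_top.ne)
      (ENNReal.rpow_ne_top_of_nonneg (by norm_num) enorm_ne_top)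
  have hm := hausdorff_aestronglyMeasurable hK hf
  have hm2 : AEMeasurable (fun x : ℝ => (∫⁻ u, ‖K u‖ₑ * ‖f (u * x)‖ₑ) ^ (2 : ℝ)) volume := by
    have := hm.enorm.lintegral_prod_right'
    simp only [enorm_mul] at this
    exact this.pow_const _
  filter_upwards [ae_lt_top' hm2 hfin, hm.prodMk_left] with x hx hx2
  refine ⟨hx2, ?_⟩
  rw [hasFiniteIntegral_iff_enorm]
  simp only [enorm_mul]
  by_contra hcon
  rw [not_lt, top_le_iff] at hcon
  rw [hcon] at hx
  simp at hx

lemma hausdorff_eLpNorm_le {K : ℝ → ℂ} (hK : HausdorffKernel K) (f : L2R) :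
    eLpNorm (hausdorffFun K f) 2 volume ≤ hausdorffBound K * ‖f‖ₑ := by
  have h := hausdorff_minkowski hK (Lp.stronglyMeasurable f)
  rw [lintegral_sq_L2, ← ENNReal.mul_rpow_of_nonneg _ _ (by norm_num)] at h
  rw [eLpNorm_eq_lintegral_rpow_enorm_toReal (by simp) (by simp)]
  have h2 : ∫⁻ x, ‖hausdorffFun K f x‖ₑ ^ (2 : ℝ) ≤ (hausdorffBound K * ‖f‖ₑ) ^ (2 : ℝ) := by
    refine le_trans (lintegral_mono fun x => ?_) h
    apply ENNReal.rpow_le_rpow _ (by norm_num)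
    refine (enorm_integral_le_lintegral_enorm _).trans_eq ?_
    simp only [enorm_mul]
  have h3 := ENNReal.rpow_le_rpow h2 (show (0 : ℝ) ≤ 1 / 2 by norm_num)
  rw [← ENNReal.rpow_mul] at h3
  simpa using h3

lemma hausdorff_memLp {K : ℝ → ℂ} (hK : HausdorffKernel K) (f : L2R) :
    MemLp (hausdorffFun K f) 2 volume :=
  ⟨(hausdorff_aestronglyMeasurable hK (Lp.stronglyMeasurable f)).integral_prod_right',
    (hausdorff_eLpNorm_le hK f).trans_lt (ENNReal.mul_lt_top hK.lintegral_lt_top (by simp))⟩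

lemma ae_dilate {p : ℝ → Prop} (hp : ∀ᵐ t : ℝ, p t) {x : ℝ} (hx : x ≠ 0) :
    ∀ᵐ u : ℝ, p (u * x) := by
  have hq : Measure.QuasiMeasurePreserving (fun u : ℝ => u * x) volume volume := by
    refine ⟨measurable_mul_const x, ?_⟩
    rw [Real.map_volume_mul_right hx]
    exact Measure.smul_absolutelyContinuous
  exact hq.ae hp

/-- The Hausdorff operator `(H_K f)(x) = ∫ K(u) f(ux) du` as a bounded operator on `L²(ℝ)`. -/
noncomputable def hausdorffOp (K : ℝ → ℂ) (hK : HausdorffKernel K) : L2R →L[ℂ] L2R :=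
  LinearMap.mkContinuous
    { toFun := fun f => (hausdorff_memLp hK f).toLp (hausdorffFun K f)
      map_add' := by
        intro f g
        rw [← MemLp.toLp_add]
        apply MemLp.toLp_congr
        filter_upwards [hausdorff_ae_integrable hK f, hausdorff_ae_integrable hK g,
          Measure.ae_ne volume (0 : ℝ)] with x hf hg hx
        simp only [Pi.add_apply, hausdorffFun]
        rw [← integral_add hf hg]
        apply integral_congr_ae
        filter_upwards [ae_dilate (Lp.coeFn_add f g) hx] with u hu
        rw [hu, Pi.add_apply, mul_add]
      map_smul' := by
        intro c f
        rw [RingHom.id_apply, ← MemLp.toLp_const_smul]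
        apply MemLp.toLp_congr
        filter_upwards [Measure.ae_ne volume (0 : ℝ)] with x hx
        simp only [Pi.smul_apply, hausdorffFun]
        rw [← integral_smul]
        apply integral_congr_ae
        filter_upwards [ae_dilate (Lp.coeFn_smul c f) hx] with u hu
        rw [hu, Pi.smul_apply, smul_eq_mul, smul_eq_mul]
        ring }
    (hausdorffBound K).toReal
    (by
      intro f
      simp only [LinearMap.coe_mk, AddHom.coe_mk, Lp.norm_toLp]
      rw [← toReal_enorm f, ← ENNReal.toReal_mul]
      exact ENNReal.toReal_mono (ENNReal.mul_ne_top hK.lintegral_lt_top.ne (by simp))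
        (hausdorff_eLpNorm_le hK f))

lemma hausdorffOp_coeFn {K : ℝ → ℂ} (hK : HausdorffKernel K) (f : L2R) :
    hausdorffOp K hK f =ᵐ[volume] hausdorffFun K f :=
  MemLp.coeFn_toLp (hausdorff_memLp hK f)

/-- The kernel `Γ(α)⁻¹ (log (1/u))^{α-1} χ_{(0,1)}(u)` of the Hölder mean of order `α`. -/
noncomputable def holderKernel (α : ℂ) : ℝ → ℂ :=
  (Ioo (0 : ℝ) 1).indicator fun u =>
    (Complex.Gamma α)⁻¹ * ((Real.log (1 / u) : ℝ) : ℂ) ^ (α - 1)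

lemma holderKernel_hausdorffKernel {α : ℂ} (hα : 0 < α.re) : HausdorffKernel (holderKernel α) := by
  have himg : (fun t : ℝ => Real.exp (-t)) '' Ioi 0 = Ioo 0 1 := by
    ext u
    simp only [mem_image, mem_Ioi, mem_Ioo]
    constructor
    · rintro ⟨t, ht, rfl⟩
      exact ⟨Real.exp_pos _, by simpa using ht⟩
    · rintro ⟨h0, h1⟩
      exact ⟨-Real.log u, by simpa using Real.log_neg h0 h1, by simp [Real.exp_log h0]⟩
  have hder : ∀ t ∈ Ioi (0 : ℝ), HasDerivWithinAt (fun t : ℝ => Real.exp (-t))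
      (-Real.exp (-t)) (Ioi 0) t := by
    intro t _
    simpa using ((hasDerivAt_neg t).exp).hasDerivWithinAt
  have hinj : InjOn (fun t : ℝ => Real.exp (-t)) (Ioi 0) := by
    intro a _ b _ h
    simpa using h
  have key := integrableOn_image_iff_integrableOn_abs_deriv_smul measurableSet_Ioi hder hinj
    (fun u : ℝ => (Complex.Gamma α)⁻¹ * ((Real.log (1 / u) : ℝ) : ℂ) ^ (α - 1) *
      ((|u| ^ (-(1 / 2) : ℝ) : ℝ) : ℂ))
  rw [himg] at key
  have hint : IntegrableOn (fun u : ℝ => (Complex.Gamma α)⁻¹ *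
      ((Real.log (1 / u) : ℝ) : ℂ) ^ (α - 1) * ((|u| ^ (-(1 / 2) : ℝ) : ℝ) : ℂ)) (Ioo 0 1) := by
    rw [key]
    have hb := integrableOn_rpow_mul_exp_neg_mul_rpow (p := 1) (s := α.re - 1) (b := 1 / 2)
      (by linarith) one_pos (by norm_num)
    have hb2 := hb.const_mul ‖(Complex.Gamma α)⁻¹‖
    refine Integrable.mono' hb2 (Measurable.aestronglyMeasurable (by fun_prop)) ?_
    filter_upwards [ae_restrict_mem measurableSet_Ioi] with t ht
    have ht' : (0 : ℝ) < t := ht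
    have e1 : Real.log (1 / Real.exp (-t)) = t := by
      rw [one_div, ← Real.exp_neg, neg_neg, Real.log_exp]
    rw [e1, norm_smul, norm_mul, norm_mul, Complex.norm_cpow_eq_rpow_re_of_pos ht',
      Complex.norm_real, abs_neg, Real.norm_eq_abs, Real.norm_eq_abs, abs_abs,
      abs_of_pos (Real.exp_pos _), abs_of_pos (by positivity), ← Real.exp_mul]
    simp only [Complex.sub_re, Complex.one_re, Real.rpow_one]
    apply le_of_eq
    have : Real.exp (-(1 / 2) * t) = Real.exp (-t) * Real.exp (-t * -(1 / 2)) := by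
      rw [← Real.exp_add]; congr 1; ring
    rw [this]
    ring
  unfold HausdorffKernel
  rw [← integrable_indicator_iff measurableSet_Ioo] at hint
  refine hint.congr (Filter.Eventually.of_forall fun u => ?_)
  by_cases hu : u ∈ Ioo (0 : ℝ) 1 <;> simp [holderKernel, hu]

/-- The kernel `χ_{(0,1)}` of the Cesàro operator. -/
noncomputable def cesaroKernel : ℝ → ℂ := (Ioo (0 : ℝ) 1).indicator fun _ => 1

lemma cesaroKernel_hausdorffKernel : HausdorffKernel cesaroKernel := by
  have h : cesaroKernel = holderKernel 1 := by
    ext u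
    by_cases hu : u ∈ Ioo (0 : ℝ) 1 <;> simp [cesaroKernel, holderKernel, hu]
  rw [h]
  exact holderKernel_hausdorffKernel (by simp)

/-- The Cesàro operator `(C f)(x) = ∫₀¹ f(ux) du = x⁻¹ ∫₀ˣ f(t) dt` on `L²(ℝ)`. -/
noncomputable def cesaroOp : L2R →L[ℂ] L2R :=
  hausdorffOp cesaroKernel cesaroKernel_hausdorffKernel

lemma cesaroOp_coeFn (f : L2R) :
    cesaroOp f =ᵐ[volume] fun x : ℝ => (x : ℂ)⁻¹ * ∫ t in (0 : ℝ)..x, f t := by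
  filter_upwards [hausdorffOp_coeFn cesaroKernel_hausdorffKernel f,
    Measure.ae_ne volume (0 : ℝ)] with x hx h0
  have h1 : ∫ u in (0 : ℝ)..1, f (u * x) = (x⁻¹ : ℝ) • ∫ t in (0 * x)..(1 * x), f t :=
    intervalIntegral.integral_comp_mul_right (fun t => f t) h0
  have h2 : hausdorffFun cesaroKernel f x = ∫ u in (0 : ℝ)..1, f (u * x) := by
    rw [intervalIntegral.integral_of_le zero_le_one, integral_Ioc_eq_integral_Ioo,
      ← integral_indicator measurableSet_Ioo]
    refine integral_congr_ae (Filter.Eventually.of_forall fun u => ?_)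
    by_cases hu : u ∈ Ioo (0 : ℝ) 1 <;> simp [cesaroKernel, hu]
  rw [cesaroOp, hx, h2, h1]
  simp

/-- The Hölder mean `(H_α f)(x) = Γ(α)⁻¹ ∫₀¹ (log (1/u))^{α-1} f(ux) du` on `L²(ℝ)` for
`Re α > 0`, with the convention `H_0 = I` (the value for other `α` is irrelevant). -/
noncomputable def holderOp (α : ℂ) : L2R →L[ℂ] L2R :=
  if h : 0 < α.re then hausdorffOp (holderKernel α) (holderKernel_hausdorffKernel h) else 1

/-- The Riesz–Dunford integral `(2πi)⁻¹ ∫_Γ F(z) (z - C)⁻¹ dz` of the Cesàro operator `C` over the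
positively oriented boundary `Γ` of the annulus `r < |z - 1| < R`. -/
noncomputable def cesaroContourIntegral (F : ℂ → ℂ) (r R : ℝ) : L2R →L[ℂ] L2R :=
  (2 * Real.pi * Complex.I : ℂ)⁻¹ •
    ((∮ z in C(1, R), F z • resolvent cesaroOp z) - ∮ z in C(1, r), F z • resolvent cesaroOp z)

/-- `B = F(C)` in the Riesz-Dunford holomorphic functional calculus of the Cesàro operator `C`:
`F` is holomorphic on an open set `U` containing the spectrum of `C` (the circle `|z - 1| = 1`), and
`B` is the Riesz-Dunford integral over the boundary of an annulus that contains the spectrum and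
whose closure lies in `U`. -/
def IsHolomorphicCalculus (F : ℂ → ℂ) (B : L2R →L[ℂ] L2R) : Prop :=
  ∃ U : Set ℂ, IsOpen U ∧ spectrum ℂ cesaroOp ⊆ U ∧ DifferentiableOn ℂ F U ∧
    ∃ r R : ℝ, 0 < r ∧ r < R ∧
      spectrum ℂ cesaroOp ⊆ {z : ℂ | r < ‖z - 1‖ ∧ ‖z - 1‖ < R} ∧
      {z : ℂ | r ≤ ‖z - 1‖ ∧ ‖z - 1‖ ≤ R} ⊆ U ∧
      B = cesaroContourIntegral F r R

/-! Write `C` for the Cesàro operator. If `α = n` is a natural number, then `H_n = C ^ n`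
(`holderOp_natCast`), because composing Hausdorff operators convolves their kernels
multiplicatively. The function `z ^ n` represents this power: `1` lies in the resolvent set
(`one_mem_resolventSet_cesaroOp`), so the integral over a small inner circle vanishes, and the outer
circle gives `C ^ n`.

Conversely, `H_α` multiplies the power `x ^ w` by `(1 + w) ^ (-α)`. Truncating to `(0,1)` and
letting `w → -1/2 + is` gives unit vectors `g n` that are approximate eigenvectors of all `H_α` at
once, with eigenvalue `p ^ (-α)`, where `p = 1/2 + is` (`exists_approx_eigenvector`). For `C = H_1`
the eigenvalue is `p⁻¹`, and these points fill the circle `|z - 1| = 1` except `0`. Since `F(C) =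
F(p⁻¹) + Q (C - p⁻¹)` (`exists_annulus_integral_eq`), `H_α = F(C)` forces `F(p⁻¹) = p ^ (-α)`.

The spectrum is closed, so it contains `0` and `F` is analytic there. Thus `F = z ^ n g` near `0`
with `g 0 ≠ 0`. Comparing moduli as `s → ±∞` gives `Im α = 0`, then `Re α = n`
(`exists_nat_eq_of_analyticAt`). -/

/-! ### Composition of Hausdorff operators -/

lemma HausdorffKernel.norm {K : ℝ → ℂ} (hK : HausdorffKernel K) :
    HausdorffKernel (fun u => (‖K u‖ : ℂ)) := by
  refine (Integrable.ofReal (𝕜 := ℂ) (Integrable.norm hK)).congr (Filter.Eventually.of_forall fun u => ?_)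
  simp only [norm_mul, Complex.norm_real, Real.norm_eq_abs, RCLike.ofReal_mul, Complex.coe_algebraMap]
  rw [abs_of_nonneg (Real.rpow_nonneg (abs_nonneg u) _)]

/-- The double integral defining the composition of two Hausdorff operators converges
absolutely for almost every `x`. -/
lemma hausdorff_ae_integrable_comp {K L : ℝ → ℂ} (hK : HausdorffKernel K) (hL : HausdorffKernel L)
    (f : L2R) :
    ∀ᵐ x : ℝ, Integrable (fun u : ℝ => ‖K u‖ * ∫ t : ℝ, ‖L t‖ * ‖f (t * (u * x))‖) volume := by
  have hf : MemLp (fun x => (‖f x‖ : ℂ)) 2 volume := (Lp.memLp f).norm.ofReal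
  set g : L2R := hf.toLp _ with hg
  -- Single-operator integrability, applied to the `L²` function obtained from `|f|` by the operator
  -- with kernel `|L|`.
  filter_upwards [hausdorff_ae_integrable hK (hausdorffOp _ hL.norm g),
    Measure.ae_ne volume (0 : ℝ)] with x hx h0
  refine hx.norm.congr ?_
  filter_upwards [ae_dilate (hausdorffOp_coeFn hL.norm g) h0, Measure.ae_ne volume (0 : ℝ)]
    with u hu hu0
  rw [norm_mul, hu]
  congr 1
  have : hausdorffFun (fun u => (‖L u‖ : ℂ)) g (u * x) =
      ((∫ t : ℝ, ‖L t‖ * ‖f (t * (u * x))‖ : ℝ) : ℂ) := by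
    rw [← integral_complex_ofReal]
    apply integral_congr_ae
    filter_upwards [ae_dilate hf.coeFn_toLp (mul_ne_zero hu0 h0)] with t ht
    rw [ht]
    push_cast
    rfl
  rw [this, Complex.norm_real, Real.norm_of_nonneg (by positivity)]

lemma integral_dilate_eq {g : ℝ → ℂ} {u : ℝ} (hu : u ≠ 0) :
    ∫ v, ((|u|⁻¹ : ℝ) : ℂ) * g (v / u) = ∫ t, g t := by
  rw [integral_const_mul, Measure.integral_comp_div, Complex.real_smul, ← mul_assoc,
    ← Complex.ofReal_mul, inv_mul_cancel₀ (abs_ne_zero.mpr hu)]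
  simp

/-- The composition of two Hausdorff operators is the Hausdorff operator whose kernel is the
multiplicative convolution of their kernels. -/
theorem hausdorffOp_comp {K L M : ℝ → ℂ} (hK : HausdorffKernel K) (hL : HausdorffKernel L)
    (hM : HausdorffKernel M) (hKm : Measurable K) (hLm : Measurable L)
    (h : ∀ᵐ v : ℝ, M v = ∫ u : ℝ, ((|u|⁻¹ : ℝ) : ℂ) * K u * L (v / u)) :
    hausdorffOp K hK * hausdorffOp L hL = hausdorffOp M hM := by
  ext1 f
  apply Lp.ext
  refine (hausdorffOp_coeFn hK _).trans (Filter.EventuallyEq.trans ?_ (hausdorffOp_coeFn hM f).symm)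
  have hL2 : ∀ᵐ x : ℝ, Integrable (fun t : ℝ => L t * f (t * x)) volume :=
    hausdorff_ae_integrable hL f
  filter_upwards [hausdorff_ae_integrable_comp hK hL f, Measure.ae_ne volume (0 : ℝ)] with x hx h0
  -- The iterated integrand after substituting `v = t * u`, with Jacobian `|u|⁻¹`; now `f` depends
  -- on `v` alone, and swapping the integrals exposes the convolution.
  set G : ℝ → ℝ → ℂ := fun u v => ((|u|⁻¹ : ℝ) : ℂ) * K u * L (v / u) * f (v * x) with hG
  have e : ∀ u : ℝ, u ≠ 0 → ∀ v, G u v =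
      ((|u|⁻¹ : ℝ) : ℂ) * (fun t => K u * (L t * f (t * (u * x)))) (v / u) := by
    intro u hu v
    simp only [hG]
    have : v / u * (u * x) = v * x := by field_simp
    rw [this]; ring
  have hfm := (Lp.stronglyMeasurable f).measurable
  have hGi : Integrable (Function.uncurry G) (volume.prod volume) := by
    rw [integrable_prod_iff]
    · constructor
      · filter_upwards [ae_dilate hL2 h0, Measure.ae_ne volume (0 : ℝ)] with u hu hu0
        simp only [Function.uncurry, e u hu0]
        exact ((hu.const_mul (K u)).comp_div hu0).const_mul _
      · refine hx.congr ?_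
        filter_upwards [Measure.ae_ne volume (0 : ℝ)] with u hu0
        simp only [Function.uncurry, e u hu0]
        have h1 := integral_dilate_eq (g := fun t => ((‖K u‖ * (‖L t‖ * ‖f (t * (u * x))‖) : ℝ) : ℂ)) hu0
        rw [integral_complex_ofReal] at h1
        simp_rw [← Complex.ofReal_mul] at h1
        rw [integral_complex_ofReal, Complex.ofReal_inj] at h1
        rw [← integral_const_mul, ← h1]
        refine integral_congr_ae (Filter.Eventually.of_forall fun v => ?_)
        simp [Real.norm_eq_abs]
    · apply Measurable.aestronglyMeasurable
      unfold Function.uncurry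
      fun_prop
  calc hausdorffFun K (hausdorffOp L hL f) x = ∫ u, ∫ v, G u v := by
        apply integral_congr_ae
        filter_upwards [ae_dilate (hausdorffOp_coeFn hL f) h0, Measure.ae_ne volume (0 : ℝ)]
          with u hu hu0
        rw [hu]
        simp only [e u hu0]
        rw [integral_dilate_eq (g := fun t => K u * (L t * f (t * (u * x)))) hu0,
          integral_const_mul]
        rfl
    _ = ∫ v, ∫ u, G u v := integral_integral_swap hGi
    _ = hausdorffFun M f x := by
        apply integral_congr_ae
        filter_upwards [h] with v hv
        rw [hv, ← integral_mul_const]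

lemma holderKernel_measurable (α : ℂ) : Measurable (holderKernel α) :=
  Measurable.indicator (by fun_prop) measurableSet_Ioo

lemma cesaroKernel_eq : cesaroKernel = holderKernel 1 := by
  ext u
  by_cases hu : u ∈ Ioo (0 : ℝ) 1 <;> simp [cesaroKernel, holderKernel, hu]

lemma hausdorffOp_congr {K L : ℝ → ℂ} (h : K = L) (hK : HausdorffKernel K)
    (hL : HausdorffKernel L) : hausdorffOp K hK = hausdorffOp L hL := by
  subst h; rfl

lemma holderOp_one : holderOp 1 = cesaroOp := by
  rw [holderOp, dif_pos (by simp)]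
  exact hausdorffOp_congr cesaroKernel_eq.symm _ _

/-! ### Invertibility of `1 - C` -/

/-- The kernel `χ_{(1,∞)}(u) / u` of the adjoint of the Cesàro operator. -/
noncomputable def cesaroAdjointKernel : ℝ → ℂ := (Ioi (1 : ℝ)).indicator fun u => ((u⁻¹ : ℝ) : ℂ)

lemma cesaroAdjointKernel_hausdorffKernel : HausdorffKernel cesaroAdjointKernel := by
  have h : IntegrableOn (fun u : ℝ => ((u ^ (-(3 / 2) : ℝ) : ℝ) : ℂ)) (Ioi 1) :=
    Integrable.ofReal (integrableOn_Ioi_rpow_of_lt (by norm_num) one_pos)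
  rw [← integrable_indicator_iff measurableSet_Ioi] at h
  refine h.congr (Filter.Eventually.of_forall fun u => ?_)
  by_cases hu : u ∈ Ioi (1 : ℝ)
  · have : (0 : ℝ) < u := one_pos.trans hu
    simp only [cesaroAdjointKernel, hu, indicator_of_mem]
    rw [← Complex.ofReal_mul, abs_of_pos this, ← Real.rpow_neg_one, ← Real.rpow_add this]
    norm_num
  · simp [cesaroAdjointKernel, hu]

/-- The operator `f ↦ ∫₁^∞ f(ux) du / u`, the adjoint of the Cesàro operator. -/
noncomputable def cesaroAdjoint : L2R →L[ℂ] L2R :=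
  hausdorffOp cesaroAdjointKernel cesaroAdjointKernel_hausdorffKernel

lemma cesaroKernel_measurable : Measurable cesaroKernel :=
  measurable_const.indicator measurableSet_Ioo

lemma cesaroAdjointKernel_measurable : Measurable cesaroAdjointKernel :=
  Measurable.indicator (by fun_prop) measurableSet_Ioi

lemma HausdorffKernel.add {K L : ℝ → ℂ} (hK : HausdorffKernel K) (hL : HausdorffKernel L) :
    HausdorffKernel (K + L) := by
  refine (Integrable.add hK hL).congr (Filter.Eventually.of_forall fun u => ?_)
  simp [add_mul]

lemma hausdorffOp_add {K L : ℝ → ℂ} (hK : HausdorffKernel K) (hL : HausdorffKernel L) :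
    hausdorffOp K hK + hausdorffOp L hL = hausdorffOp (K + L) (hK.add hL) := by
  ext1 f
  apply Lp.ext
  refine (Lp.coeFn_add _ _).trans ?_
  filter_upwards [hausdorffOp_coeFn hK f, hausdorffOp_coeFn hL f,
    hausdorffOp_coeFn (hK.add hL) f, hausdorff_ae_integrable hK f,
    hausdorff_ae_integrable hL f] with x h1 h2 h3 h4 h5
  change (hausdorffOp K hK f) x + (hausdorffOp L hL f) x = _
  rw [h1, h2, h3, hausdorffFun, hausdorffFun, hausdorffFun, ← integral_add h4 h5]
  simp [add_mul]

/-- A closed form to compare with both convolutions below. The point `1` is excluded because both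
open indicators vanish there. -/
lemma cesaroKernel_add_adjoint (v : ℝ) (hv : v ≠ 1) : (cesaroKernel + cesaroAdjointKernel) v =
    if 0 < v then ((max 1 v)⁻¹ : ℝ) else (0 : ℝ) := by
  simp only [Pi.add_apply, cesaroKernel, cesaroAdjointKernel, indicator_apply, mem_Ioo, mem_Ioi]
  rcases lt_trichotomy v 1 with h | h | h
  · by_cases h0 : 0 < v <;> simp [h0, h, h.le, not_lt.mpr h.le]
  · exact absurd h hv
  · have : 0 < v := by linarith
    simp [this, h, h.le, not_lt.mpr h.le]

/-- This is `(1 - C)(1 - C*) = 1` in disguise. For `v > 0` the convolution of the kernels is `∫ u in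
0..min 1 v, v⁻¹ = 1 / max 1 v`. -/
lemma cesaroOp_mul_adjoint : cesaroOp * cesaroAdjoint = cesaroOp + cesaroAdjoint := by
  rw [cesaroOp, cesaroAdjoint, hausdorffOp_add]
  apply hausdorffOp_comp _ _ _ cesaroKernel_measurable cesaroAdjointKernel_measurable
  filter_upwards [Measure.ae_ne volume (1 : ℝ), Measure.ae_ne volume (0 : ℝ)] with v hv hv0
  rw [cesaroKernel_add_adjoint v hv]
  have e : ∀ u : ℝ, ((|u|⁻¹ : ℝ) : ℂ) * cesaroKernel u * cesaroAdjointKernel (v / u) =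
      (Ioo 0 (min 1 v)).indicator (fun _ => ((v⁻¹ : ℝ) : ℂ)) u := by
    intro u
    simp only [cesaroKernel, cesaroAdjointKernel, indicator_apply, mem_Ioo, mem_Ioi, lt_min_iff]
    by_cases h : 0 < u
    · simp only [one_lt_div h]
      by_cases h1 : u < 1 <;> by_cases h2 : u < v <;> simp [h, h1, h2, abs_of_pos h]
      have : (u : ℂ) ≠ 0 := by exact_mod_cast h.ne'
      field_simp
    · simp [h]
  simp_rw [e]
  rw [integral_indicator measurableSet_Ioo, setIntegral_const, Real.volume_real_Ioo, sub_zero]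
  split_ifs with h
  · rw [Complex.real_smul, ← Complex.ofReal_mul]
    congr 1
    rcases le_total 1 v with h1 | h1
    · simp [h1]
    · simp [h1, h.ne', h.le]
  · rw [max_eq_right (by simp; right; linarith)]
    simp

/-- The other order: here the convolution is the integral of `u⁻²` over `(max 1 v, ∞)`, again `1 /
max 1 v`. -/
lemma adjoint_mul_cesaroOp : cesaroAdjoint * cesaroOp = cesaroOp + cesaroAdjoint := by
  rw [cesaroOp, cesaroAdjoint, hausdorffOp_add]
  apply hausdorffOp_comp _ _ _ cesaroAdjointKernel_measurable cesaroKernel_measurable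
  filter_upwards [Measure.ae_ne volume (1 : ℝ), Measure.ae_ne volume (0 : ℝ)] with v hv hv0
  rw [cesaroKernel_add_adjoint v hv]
  split_ifs with h0
  · have e : ∀ u : ℝ, ((|u|⁻¹ : ℝ) : ℂ) * cesaroAdjointKernel u * cesaroKernel (v / u) =
        (Ioi (max 1 v)).indicator (fun u => ((u ^ (-2 : ℝ) : ℝ) : ℂ)) u := by
      intro u
      simp only [cesaroKernel, cesaroAdjointKernel, indicator_apply, mem_Ioo, mem_Ioi, max_lt_iff]
      by_cases h1 : 1 < u
      · have h : 0 < u := one_pos.trans h1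
        simp only [div_lt_one h]
        by_cases h2 : v < u <;> simp [h, h1, h2, h0, abs_of_pos h]
        rw [sq, mul_inv]
      · simp [h1]
    simp_rw [e]
    rw [integral_indicator measurableSet_Ioi, integral_complex_ofReal,
      integral_Ioi_rpow_of_lt (by norm_num) (by positivity)]
    norm_num
    rw [Real.rpow_neg_one]
    simp
  · rw [integral_eq_zero_of_ae]
    · simp
    refine Filter.Eventually.of_forall fun u => ?_
    simp only [cesaroKernel, cesaroAdjointKernel, indicator_apply, mem_Ioo, mem_Ioi]
    by_cases h1 : 1 < u
    · have : ¬ 0 < v / u := by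
        rw [not_lt]; exact div_nonpos_of_nonpos_of_nonneg (not_lt.mp h0) (by linarith)
      simp [this]
    · simp [h1]

/-- The two product identities make `1 - C*` the inverse of `1 - C`. This leaves room for the inner
contour circle around `1`. -/
lemma one_mem_resolventSet_cesaroOp : (1 : ℂ) ∈ resolventSet ℂ cesaroOp := by
  rw [spectrum.mem_resolventSet_iff, map_one]
  refine isUnit_iff_exists.mpr ⟨1 - cesaroAdjoint, ?_, ?_⟩
  · rw [sub_mul, mul_sub, mul_sub, cesaroOp_mul_adjoint]; simp
  · rw [sub_mul, mul_sub, mul_sub, adjoint_mul_cesaroOp]; simp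

/-! ### Hölder means of integer order -/

/-- With `n = m + 1`, the convolution at `v ∈ (0,1)` is `∫ u in v..1, log (u/v) ^ m / m! * u⁻¹ = log
(1/v) ^ (m+1) / (m+1)!`. The case `n = 0` is excluded because `H_0 = I` is defined by convention,
not by a kernel. -/
lemma cesaroOp_mul_holderOp {n : ℕ} (hn : n ≠ 0) :
    cesaroOp * holderOp n = holderOp (n + 1 : ℕ) := by
  have h1 : 0 < ((n : ℕ) : ℂ).re := by simpa [Nat.pos_iff_ne_zero] using hn
  have h2 : 0 < ((n + 1 : ℕ) : ℂ).re := by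
    rw [Complex.natCast_re]; positivity
  rw [holderOp, dif_pos h1, holderOp, dif_pos h2, cesaroOp]
  apply hausdorffOp_comp _ _ _ cesaroKernel_measurable (holderKernel_measurable _)
  filter_upwards [Measure.ae_ne volume (0 : ℝ)] with v hv0
  obtain ⟨m, rfl⟩ := Nat.exists_eq_succ_of_ne_zero hn
  have e : ∀ u : ℝ, ((|u|⁻¹ : ℝ) : ℂ) * cesaroKernel u * holderKernel (m + 1 : ℕ) (v / u) =
      if 0 < v then (Ioo v 1).indicator
        (fun u => (((m.factorial : ℝ)⁻¹ * (Real.log (u / v) ^ m * u⁻¹) : ℝ) : ℂ)) u else 0 := by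
    intro u
    simp only [cesaroKernel, holderKernel, indicator_apply, mem_Ioo]
    by_cases h : 0 < u
    · simp only [div_lt_one h, div_pos_iff_of_pos_right h, one_div_div]
      by_cases h1 : u < 1 <;> by_cases h2 : v < u <;> by_cases h3 : 0 < v <;>
        simp [h, h1, h2, h3, abs_of_pos h, Complex.Gamma_nat_eq_factorial]
      ring
    · by_cases h3 : 0 < v
      · simp [h, h3]
        intro h4; exact absurd (h3.trans h4) h
      · simp [h, h3]
  simp only [Nat.succ_eq_add_one, e]
  by_cases h3 : 0 < v
  swap
  · simp [h3, holderKernel]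
  simp only [h3, if_true]
  rw [integral_indicator measurableSet_Ioo, ← integral_Ioc_eq_integral_Ioo]
  by_cases h4 : v < 1
  swap
  · simp [h4, holderKernel]
  rw [integral_complex_ofReal, ← intervalIntegral.integral_of_le h4.le,
    intervalIntegral.integral_const_mul]
  have hd : ∀ u ∈ uIcc v 1, HasDerivAt (fun u => Real.log (u / v) ^ (m + 1) / (m + 1))
      (Real.log (u / v) ^ m * u⁻¹) u := by
    intro u hu
    rw [uIcc_of_le h4.le] at hu
    have hu0 : 0 < u := h3.trans_le hu.1
    have := ((((hasDerivAt_id u).div_const v).log (div_pos hu0 h3).ne').pow (m + 1)).div_const (m + 1 : ℝ)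
    convert! this using 1
    simp
    field_simp
  have hi : IntervalIntegrable (fun u => Real.log (u / v) ^ m * u⁻¹) volume v 1 := by
    apply ContinuousOn.intervalIntegrable
    rw [uIcc_of_le h4.le]
    intro u hu
    have hu0 : 0 < u := h3.trans_le hu.1
    have : u / v ≠ 0 := (div_pos hu0 h3).ne'
    apply ContinuousAt.continuousWithinAt
    have h5 := hu0.ne'
    fun_prop (disch := assumption)
  rw [intervalIntegral.integral_eq_sub_of_hasDerivAt hd hi]
  simp [holderKernel, h3, h4, hv0]
  have := Complex.Gamma_nat_eq_factorial (m + 1)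
  push_cast at this
  rw [this, Nat.factorial_succ]
  push_cast
  have h6 : (m : ℂ) + 1 ≠ 0 := by exact_mod_cast Nat.succ_ne_zero m
  have h7 : (m.factorial : ℂ) ≠ 0 := by exact_mod_cast m.factorial_ne_zero
  have h8 : (-(Real.log v : ℂ)) ^ ((m : ℂ) + 1) = (-(Real.log v : ℂ)) ^ (m + 1) := by
    exact_mod_cast Complex.cpow_natCast (-(Real.log v : ℂ)) (m + 1)
  rw [h8]
  field_simp

lemma holderOp_natCast (n : ℕ) : holderOp n = cesaroOp ^ n := by
  induction n with
  | zero => simp [holderOp]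
  | succ n ih =>
    rcases eq_or_ne n 0 with rfl | hn
    · simpa using holderOp_one
    · rw [← cesaroOp_mul_holderOp hn, ih, pow_succ']

/-! ### Riesz–Dunford integrals in a Banach algebra -/

section RieszDunford

open Metric

variable {A : Type*} [NormedRing A] [NormedAlgebra ℂ A]

lemma algebraMap_sub_mul_resolvent {a : A} {z : ℂ} (hz : z ∈ resolventSet ℂ a) :
    (algebraMap ℂ A z - a) * resolvent a z = 1 :=
  Ring.mul_inverse_cancel _ hz

lemma resolvent_mul_algebraMap_sub {a : A} {z : ℂ} (hz : z ∈ resolventSet ℂ a) :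
    resolvent a z * (algebraMap ℂ A z - a) = 1 :=
  Ring.inverse_mul_cancel _ hz

/-- Follows from `a - w = (z - w) - (z - a)`. The scalar term produces Cauchy's formula for `F`; the
remainder has `a - w` as a right factor and so is small on approximate eigenvectors. -/
lemma resolvent_eq_inv_smul_add {a : A} {z w : ℂ} (hz : z ∈ resolventSet ℂ a) (hw : z ≠ w) :
    resolvent a z = (z - w)⁻¹ • 1 + (z - w)⁻¹ • (resolvent a z * (a - algebraMap ℂ A w)) := by
  have h : a - algebraMap ℂ A w = (z - w) • 1 - (algebraMap ℂ A z - a) := by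
    simp only [Algebra.algebraMap_eq_smul_one, sub_smul]; abel
  rw [h, mul_sub, resolvent_mul_algebraMap_sub hz, mul_smul_comm, mul_one, smul_sub,
    inv_smul_smul₀ (sub_ne_zero.mpr hw)]
  abel

lemma resolvent_eq_inv_smul_add' {a : A} {z w : ℂ} (hz : z ∈ resolventSet ℂ a) (hw : z ≠ w) :
    resolvent a z = (z - w)⁻¹ • 1 + (z - w)⁻¹ • ((a - algebraMap ℂ A w) * resolvent a z) := by
  have h : a - algebraMap ℂ A w = (z - w) • 1 - (algebraMap ℂ A z - a) := by
    simp only [Algebra.algebraMap_eq_smul_one, sub_smul]; abel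
  rw [h, sub_mul, algebraMap_sub_mul_resolvent hz, smul_mul_assoc, one_mul, smul_sub,
    inv_smul_smul₀ (sub_ne_zero.mpr hw)]
  abel

lemma mem_resolventSet_of_notMem {a : A} {z : ℂ} (h : z ∉ spectrum ℂ a) :
    z ∈ resolventSet ℂ a := by
  simpa [spectrum] using h

variable [CompleteSpace A]

lemma circleIntegral_mul_const {f : ℂ → A} {c : ℂ} {R : ℝ} (hf : CircleIntegrable f c R) (a : A) :
    (∮ z in C(c, R), f z * a) = (∮ z in C(c, R), f z) * a := by
  have := ((ContinuousLinearMap.mul ℂ A).flip a).intervalIntegral_comp_comm hf.out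
  simp only [ContinuousLinearMap.flip_apply, ContinuousLinearMap.mul_apply', smul_mul_assoc] at this
  exact this

lemma circleIntegral_const_mul {f : ℂ → A} {c : ℂ} {R : ℝ} (hf : CircleIntegrable f c R) (a : A) :
    (∮ z in C(c, R), a * f z) = a * ∮ z in C(c, R), f z := by
  have := (ContinuousLinearMap.mul ℂ A a).intervalIntegral_comp_comm hf.out
  simp only [ContinuousLinearMap.mul_apply', mul_smul_comm] at this
  exact this

lemma differentiableOn_resolvent (a : A) : DifferentiableOn ℂ (resolvent a) (resolventSet ℂ a) :=
  fun _ hz => (spectrum.hasDerivAt_resolvent_const_left hz).differentiableAt.differentiableWithinAt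

/-- The resolvent integrates to `2πi` over a circle enclosing the spectrum. -/
lemma circleIntegral_resolvent {a : A} {c : ℂ} {R : ℝ} (hR : 0 < R)
    (h : spectrum ℂ a ⊆ ball c R) :
    (∮ z in C(c, R), resolvent a z) = (2 * Real.pi * Complex.I : ℂ) • (1 : A) := by
  have hmem : ∀ z, R ≤ ‖z - c‖ → z ∈ resolventSet ℂ a := by
    intro z hz
    refine mem_resolventSet_of_notMem fun hz' => ?_
    have := h hz'
    rw [mem_ball_iff_norm] at this
    linarith
  -- Enlarge the circle until the resolvent is below `ε`. The error `(z - c)⁻¹ (a - c) (z - a)⁻¹`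
  -- then integrates to `O(ε)`, the radius cancelling against the length.
  have key : ∀ ε > 0, ‖(∮ z in C(c, R), resolvent a z) - (2 * Real.pi * Complex.I : ℂ) • (1 : A)‖
      ≤ 2 * Real.pi * (‖a - algebraMap ℂ A c‖ * ε) := by
    intro ε hε
    have hev : ∀ᶠ z in Bornology.cobounded ℂ, ‖resolvent a z‖ < ε := by
      have := (spectrum.resolvent_tendsto_cobounded a (𝕜 := ℂ)).norm
      rw [norm_zero] at this
      exact this.eventually_lt_const hε
    obtain ⟨B, hB⟩ : ∃ B : ℝ, ∀ z : ℂ, B ≤ ‖z‖ → ‖resolvent a z‖ < ε := by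
      obtain ⟨B, -, hB⟩ := (Filter.hasBasis_cobounded_norm (E := ℂ)).eventually_iff.mp hev
      exact ⟨B, fun z hz => hB hz⟩
    set R' := max R (B + ‖c‖) with hR'
    have hRR' : R ≤ R' := le_max_left _ _
    have hR'0 : 0 < R' := hR.trans_le hRR'
    have h1 : (∮ z in C(c, R'), resolvent a z) = ∮ z in C(c, R), resolvent a z := by
      have hsub : closedBall c R' \ ball c R ⊆ resolventSet ℂ a := by
        rintro z ⟨_, hz⟩
        rw [mem_ball_iff_norm, not_lt] at hz
        exact hmem z hz
      apply Complex.circleIntegral_eq_of_differentiable_on_annulus_off_countable hR hRR'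
        countable_empty ((differentiableOn_resolvent a).continuousOn.mono hsub)
      rintro z ⟨⟨_, hz⟩, -⟩
      rw [mem_closedBall_iff_norm, not_le] at hz
      exact (differentiableOn_resolvent a).differentiableAt
        ((spectrum.isOpen_resolventSet a).mem_nhds (hmem z hz.le))
    have hmem' : ∀ z ∈ sphere c R', z ∈ resolventSet ℂ a ∧ z ≠ c ∧ ‖resolvent a z‖ ≤ ε := by
      intro z hz
      rw [mem_sphere_iff_norm] at hz
      refine ⟨hmem z (hz ▸ hRR'), ?_, (hB z ?_).le⟩
      · rintro rfl
        simp at hz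
        linarith
      · have h2 := norm_sub_le z c
        have h3 : B + ‖c‖ ≤ R' := le_max_right _ _
        linarith
    have hcont : ContinuousOn (resolvent a) (sphere c R') :=
      (differentiableOn_resolvent a).continuousOn.mono fun z hz => (hmem' z hz).1
    have hinv : ContinuousOn (fun z : ℂ => (z - c)⁻¹) (sphere c R') :=
      (continuousOn_id.sub continuousOn_const).inv₀ fun z hz => sub_ne_zero.mpr (hmem' z hz).2.1
    have h2 : (∮ z in C(c, R'), resolvent a z) = (2 * Real.pi * Complex.I : ℂ) • (1 : A) +
        ∮ z in C(c, R'), (z - c)⁻¹ • ((a - algebraMap ℂ A c) * resolvent a z) := by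
      rw [← circleIntegral.integral_sub_center_inv c hR'0.ne',
        ← circleIntegral.integral_smul_const, ← circleIntegral.integral_add]
      · apply circleIntegral.integral_congr hR'0.le
        intro z hz
        exact resolvent_eq_inv_smul_add' (hmem' z hz).1 (hmem' z hz).2.1
      · exact (hinv.smul continuousOn_const).circleIntegrable hR'0.le
      · exact (hinv.smul (continuousOn_const.mul hcont)).circleIntegrable hR'0.le
    rw [← h1, h2, add_sub_cancel_left]
    have h3 := circleIntegral.norm_integral_le_of_norm_le_const (c := c) (R := R')
      (C := R'⁻¹ * (‖a - algebraMap ℂ A c‖ * ε))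
      (f := fun z => (z - c)⁻¹ • ((a - algebraMap ℂ A c) * resolvent a z)) hR'0.le (by
        intro z hz
        have h4 := (hmem' z hz).2.2
        rw [mem_sphere_iff_norm] at hz
        rw [norm_smul, norm_inv, hz]
        gcongr
        exact (norm_mul_le _ _).trans (by gcongr))
    refine h3.trans_eq ?_
    field_simp
  rw [← sub_eq_zero, ← norm_le_zero_iff]
  refine ge_of_tendsto (f := fun ε : ℝ => 2 * Real.pi * (‖a - algebraMap ℂ A c‖ * ε))
    (x := nhdsWithin 0 (Ioi 0)) ?_ (by filter_upwards [self_mem_nhdsWithin] with ε hε using key ε hε)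
  have : Filter.Tendsto (fun ε : ℝ => 2 * Real.pi * (‖a - algebraMap ℂ A c‖ * ε)) (nhds 0)
      (nhds (2 * Real.pi * (‖a - algebraMap ℂ A c‖ * 0))) := by
    apply Continuous.tendsto (by fun_prop)
  simp only [mul_zero] at this
  exact this.mono_left nhdsWithin_le_nhds

/-- The Cauchy integral of `z ^ n` against the resolvent over a circle enclosing the spectrum. -/
lemma circleIntegral_pow_smul_resolvent {a : A} {c : ℂ} {R : ℝ} (hR : 0 < R)
    (h : spectrum ℂ a ⊆ ball c R) (n : ℕ) :
    (∮ z in C(c, R), z ^ n • resolvent a z) = (2 * Real.pi * Complex.I : ℂ) • a ^ n := by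
  have hmem : ∀ z ∈ sphere c R, z ∈ resolventSet ℂ a := fun z hz =>
    mem_resolventSet_of_notMem fun hz' => sphere_disjoint_ball.le_bot ⟨hz, h hz'⟩
  have hcont : ContinuousOn (resolvent a) (sphere c R) :=
    (differentiableOn_resolvent a).continuousOn.mono hmem
  induction n with
  | zero => simpa using circleIntegral_resolvent hR h
  | succ n ih =>
    have hn : CircleIntegrable (fun z => z ^ n • resolvent a z) c R :=
      ((continuousOn_id.pow n).smul hcont).circleIntegrable hR.le
    -- Uses `z (z - a)⁻¹ = 1 + a (z - a)⁻¹`; the polynomial term integrates to `0` by Cauchy.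
    have h1 : (∮ z in C(c, R), z ^ (n + 1) • resolvent a z) =
        ∮ z in C(c, R), (z ^ n • (1 : A) + a * (z ^ n • resolvent a z)) := by
      apply circleIntegral.integral_congr hR.le
      intro z hz
      have := algebraMap_sub_mul_resolvent (hmem z hz)
      rw [sub_mul, Algebra.algebraMap_eq_smul_one, smul_mul_assoc, one_mul, sub_eq_iff_eq_add] at this
      simp only [pow_succ, mul_smul, this, smul_add, mul_smul_comm]
    have h2 : (∮ z in C(c, R), z ^ n) = 0 :=
      Complex.circleIntegral_eq_zero_of_differentiable_on_off_countable hR.le countable_empty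
        (by fun_prop) (fun z _ => by fun_prop)
    rw [h1, circleIntegral.integral_add, circleIntegral.integral_smul_const, h2, zero_smul,
      zero_add, circleIntegral_const_mul hn, ih, mul_smul_comm, pow_succ']
    · exact ((continuousOn_id.pow n).smul continuousOn_const).circleIntegrable hR.le
    · exact (continuousOn_const.mul ((continuousOn_id.pow n).smul hcont)).circleIntegrable hR.le

/-- The difference quotient `dslope F w` is holomorphic even at `w`, so its integrals over the two
circles agree. What remains is `F w` times the integral of `(z - w)⁻¹`, which is `2πi` on the outer
circle and `0` on the inner one. -/
lemma circleIntegral_div_sub_annulus {F : ℂ → ℂ} {U : Set ℂ} (hU : IsOpen U)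
    (hF : DifferentiableOn ℂ F U) {c w : ℂ} {r R : ℝ} (hr : 0 < r)
    (hsub : closedBall c R \ ball c r ⊆ U) (hw1 : r < ‖w - c‖) (hw2 : ‖w - c‖ < R) :
    (∮ z in C(c, R), F z * (z - w)⁻¹) - (∮ z in C(c, r), F z * (z - w)⁻¹) =
      2 * Real.pi * Complex.I * F w := by
  have hrR : r < R := hw1.trans hw2
  have hwU : w ∈ U := hsub ⟨by rw [mem_closedBall_iff_norm]; exact hw2.le,
    by rw [mem_ball_iff_norm]; exact not_lt.mpr hw1.le⟩
  have hd : DifferentiableOn ℂ (dslope F w) U :=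
    (Complex.differentiableOn_dslope (hU.mem_nhds hwU)).mpr hF
  have e1 : (∮ z in C(c, R), dslope F w z) = ∮ z in C(c, r), dslope F w z := by
    apply Complex.circleIntegral_eq_of_differentiable_on_annulus_off_countable hr hrR.le
      countable_empty (hd.continuousOn.mono hsub)
    rintro z ⟨⟨h1, h2⟩, -⟩
    exact hd.differentiableAt (hU.mem_nhds (hsub
      ⟨ball_subset_closedBall h1, fun h => h2 (ball_subset_closedBall h)⟩))
  have e2 : ∀ ρ, 0 < ρ → ρ ≠ ‖w - c‖ → sphere c ρ ⊆ U →
      (∮ z in C(c, ρ), F z * (z - w)⁻¹) =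
        (∮ z in C(c, ρ), dslope F w z) + F w * ∮ z in C(c, ρ), (z - w)⁻¹ := by
    intro ρ hρ hne hρU
    have hzw : ∀ z ∈ sphere c ρ, z ≠ w := by
      rintro z hz rfl
      rw [mem_sphere_iff_norm] at hz
      exact hne hz.symm
    have hinv : ContinuousOn (fun z : ℂ => (z - w)⁻¹) (sphere c ρ) :=
      (continuousOn_id.sub continuousOn_const).inv₀ fun z hz => sub_ne_zero.mpr (hzw z hz)
    rw [← circleIntegral.integral_const_mul, ← circleIntegral.integral_add]
    · apply circleIntegral.integral_congr hρ.le
      intro z hz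
      have := sub_ne_zero.mpr (hzw z hz)
      simp only [dslope_of_ne _ (hzw z hz), slope_def_field]
      field_simp
      ring
    · exact (hd.continuousOn.mono hρU).circleIntegrable hρ.le
    · exact (continuousOn_const.mul hinv).circleIntegrable hρ.le
  have e3 : (∮ z in C(c, r), (z - w)⁻¹) = 0 := by
    have hne : ∀ z ∈ closedBall c r, z - w ≠ 0 := by
      intro z hz h
      rw [sub_eq_zero] at h
      rw [h, mem_closedBall_iff_norm] at hz
      linarith
    apply Complex.circleIntegral_eq_zero_of_differentiable_on_off_countable hr.le countable_empty
    · exact (continuousOn_id.sub continuousOn_const).inv₀ hne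
    · rintro z ⟨hz, -⟩
      exact (differentiableAt_id.sub_const w).inv (hne z (ball_subset_closedBall hz))
  rw [e2 R (hr.trans hrR) hw2.ne' fun z hz => hsub ⟨sphere_subset_closedBall hz, ?_⟩,
    e2 r hr hw1.ne fun z hz => hsub ⟨?_, ?_⟩, e1, e3,
    circleIntegral.integral_sub_inv_of_mem_ball (by rwa [mem_ball_iff_norm])]
  · ring
  · rw [mem_sphere_iff_norm] at hz
    rw [mem_closedBall_iff_norm]; linarith
  · rw [mem_sphere_iff_norm] at hz
    rw [mem_ball_iff_norm]; linarith
  · rw [mem_sphere_iff_norm] at hz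
    rw [mem_ball_iff_norm]; linarith

/-- The Riesz–Dunford integral of `F` over an annulus containing the spectrum of `a` is congruent
to `F w` modulo the left ideal generated by `a - w`. -/
lemma exists_annulus_integral_eq {a : A} {F : ℂ → ℂ} {U : Set ℂ} (hU : IsOpen U)
    (hF : DifferentiableOn ℂ F U) {c w : ℂ} {r R : ℝ} (hr : 0 < r)
    (hsub : closedBall c R \ ball c r ⊆ U)
    (hspec : ∀ z ∈ spectrum ℂ a, r < ‖z - c‖ ∧ ‖z - c‖ < R)
    (hw1 : r < ‖w - c‖) (hw2 : ‖w - c‖ < R) :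
    ∃ Q : A, (2 * Real.pi * Complex.I : ℂ)⁻¹ •
      ((∮ z in C(c, R), F z • resolvent a z) - ∮ z in C(c, r), F z • resolvent a z) =
        F w • 1 + Q * (a - algebraMap ℂ A w) := by
  have hrR : r < R := hw1.trans hw2
  set q : ℝ → A := fun ρ => ∮ z in C(c, ρ), (F z * (z - w)⁻¹) • resolvent a z with hq
  have key : ∀ ρ, 0 < ρ → ρ ≠ ‖w - c‖ → sphere c ρ ⊆ U → sphere c ρ ⊆ resolventSet ℂ a →
      (∮ z in C(c, ρ), F z • resolvent a z) =
        (∮ z in C(c, ρ), F z * (z - w)⁻¹) • (1 : A) + q ρ * (a - algebraMap ℂ A w) := by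
    intro ρ hρ hne hρU hres
    have hzw : ∀ z ∈ sphere c ρ, z ≠ w := by
      rintro z hz rfl
      rw [mem_sphere_iff_norm] at hz
      exact hne hz.symm
    have hinv : ContinuousOn (fun z : ℂ => (z - w)⁻¹) (sphere c ρ) :=
      (continuousOn_id.sub continuousOn_const).inv₀ fun z hz => sub_ne_zero.mpr (hzw z hz)
    have hFc := (hF.continuousOn.mono hρU).mul hinv
    have hRc := (differentiableOn_resolvent a).continuousOn.mono hres
    have hm := circleIntegral_mul_const ((hFc.smul hRc).circleIntegrable hρ.le)
      (a - algebraMap ℂ A w)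
    simp only [Pi.smul_apply', Pi.mul_apply] at hm
    simp only [hq]
    rw [← hm, ← circleIntegral.integral_smul_const, ← circleIntegral.integral_add]
    · apply circleIntegral.integral_congr hρ.le
      intro z hz
      simp only
      conv_lhs => rw [resolvent_eq_inv_smul_add (hres hz) (hzw z hz)]
      rw [smul_add, smul_smul, smul_smul, smul_mul_assoc]
    · exact (hFc.smul continuousOn_const).circleIntegrable hρ.le
    · exact ((hFc.smul hRc).mul continuousOn_const).circleIntegrable hρ.le
  have hres : ∀ z, (‖z - c‖ = r ∨ ‖z - c‖ = R) → z ∈ resolventSet ℂ a := by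
    intro z hz
    refine mem_resolventSet_of_notMem fun h => ?_
    obtain ⟨h1, h2⟩ := hspec z h
    rcases hz with hz | hz <;> linarith
  have hmemU : ∀ z, (‖z - c‖ = r ∨ ‖z - c‖ = R) → z ∈ U := by
    intro z hz
    refine hsub ⟨?_, ?_⟩
    · rw [mem_closedBall_iff_norm]; rcases hz with hz | hz <;> linarith
    · rw [mem_ball_iff_norm]; rcases hz with hz | hz <;> linarith
  refine ⟨(2 * Real.pi * Complex.I : ℂ)⁻¹ • (q R - q r), ?_⟩
  have hsc := circleIntegral_div_sub_annulus hU hF hr hsub hw1 hw2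
  rw [key R (hr.trans hrR) hw2.ne' (fun z hz => hmemU z (Or.inr (mem_sphere_iff_norm.mp hz)))
      (fun z hz => hres z (Or.inr (mem_sphere_iff_norm.mp hz))),
    key r hr hw1.ne (fun z hz => hmemU z (Or.inl (mem_sphere_iff_norm.mp hz)))
      (fun z hz => hres z (Or.inl (mem_sphere_iff_norm.mp hz))), add_sub_add_comm, ← sub_smul, hsc,
    ← sub_mul, smul_add, smul_smul, ← mul_assoc, inv_mul_cancel₀ Complex.two_pi_I_ne_zero, one_mul,
    smul_mul_assoc]

end RieszDunford

/-! ### Powers of `C` in the functional calculus -/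

/-- Nonnegative integer powers of the Cesàro operator are holomorphic functions of it. -/
lemma isHolomorphicCalculus_pow (n : ℕ) : IsHolomorphicCalculus (fun z => z ^ n) (cesaroOp ^ n) := by
  obtain ⟨r, hr, hball⟩ := Metric.isOpen_iff.mp (spectrum.isOpen_resolventSet (𝕜 := ℂ) cesaroOp) 1
    one_mem_resolventSet_cesaroOp
  obtain ⟨R, hR⟩ := (spectrum.isBounded (𝕜 := ℂ) cesaroOp).subset_ball (1 : ℂ)
  -- The maximum with `r` guarantees `r / 2 < R'`.
  set R' := max R r with hR'
  have hrR' : r ≤ R' := le_max_right _ _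
  have hspec : spectrum ℂ cesaroOp ⊆ Metric.ball 1 R' :=
    hR.trans (Metric.ball_subset_ball (le_max_left _ _))
  have hin : Metric.closedBall (1 : ℂ) (r / 2) ⊆ resolventSet ℂ cesaroOp :=
    (Metric.closedBall_subset_ball (by linarith)).trans hball
  refine ⟨univ, isOpen_univ, subset_univ _, by fun_prop, r / 2, R', by linarith, by linarith,
    fun z hz => ⟨?_, ?_⟩, subset_univ _, ?_⟩
  · by_contra h
    exact hz (hin (by rw [mem_closedBall_iff_norm]; exact not_lt.mp h))
  · exact mem_ball_iff_norm.mp (hspec hz)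
  -- The whole inner disc lies in the resolvent set, so the integrand is holomorphic there and only
  -- the outer circle contributes.
  · have h0 : (∮ z in C(1, r / 2), z ^ n • resolvent cesaroOp z) = 0 := by
      apply Complex.circleIntegral_eq_zero_of_differentiable_on_off_countable (by linarith)
        countable_empty
      · exact (continuousOn_id.pow n).smul
          ((differentiableOn_resolvent cesaroOp).continuousOn.mono hin)
      · rintro z ⟨hz, -⟩
        exact (differentiableAt_id.pow n).smul ((differentiableOn_resolvent cesaroOp).differentiableAt
          ((spectrum.isOpen_resolventSet _).mem_nhds (hin (Metric.ball_subset_closedBall hz))))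
    rw [cesaroContourIntegral, h0, circleIntegral_pow_smul_resolvent (by linarith) hspec, sub_zero,
      inv_smul_smul₀ Complex.two_pi_I_ne_zero]

/-! ### Laplace and Mellin transforms of the Hölder kernel -/

lemma norm_cpow_mul_exp_neg {α w : ℂ} {t : ℝ} (ht : 0 < t) :
    ‖(t : ℂ) ^ (α - 1) * Complex.exp (-(w * t))‖ = t ^ (α.re - 1) * Real.exp (-w.re * t) := by
  rw [norm_mul, Complex.norm_cpow_eq_rpow_re_of_pos ht, Complex.norm_exp]
  simp

lemma integrableOn_rpow_mul_exp_neg_mul {s b : ℝ} (hs : -1 < s) (hb : 0 < b) :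
    IntegrableOn (fun t : ℝ => t ^ s * Real.exp (-b * t)) (Ioi 0) := by
  simpa using integrableOn_rpow_mul_exp_neg_mul_rpow hs one_pos hb

lemma integrableOn_cpow_mul_exp_neg_mul {α w : ℂ} (hα : 0 < α.re) (hw : 0 < w.re) :
    IntegrableOn (fun t : ℝ => (t : ℂ) ^ (α - 1) * Complex.exp (-(w * t))) (Ioi 0) := by
  refine Integrable.mono' (integrableOn_rpow_mul_exp_neg_mul (s := α.re - 1) (by linarith) hw)
    (Measurable.aestronglyMeasurable (by fun_prop)) ?_
  filter_upwards [ae_restrict_mem measurableSet_Ioi] with t ht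
  exact (norm_cpow_mul_exp_neg ht).le

lemma differentiableAt_integral_cpow_mul_exp_neg_mul {α w : ℂ} (hα : 0 < α.re) (hw : 0 < w.re) :
    DifferentiableAt ℂ
      (fun z : ℂ => ∫ t in Ioi (0 : ℝ), (t : ℂ) ^ (α - 1) * Complex.exp (-(z * t))) w := by
  -- Staying in this half-plane gives an exponential bound on the derivative that is uniform in `z`.
  have hs : {z : ℂ | w.re / 2 < z.re} ∈ nhds w :=
    (isOpen_lt continuous_const Complex.continuous_re).mem_nhds (by simp; linarith)
  refine (hasDerivAt_integral_of_dominated_loc_of_deriv_le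
    (F := fun z t => (t : ℂ) ^ (α - 1) * Complex.exp (-(z * t)))
    (F' := fun z t => (t : ℂ) ^ (α - 1) * (Complex.exp (-(z * t)) * -t))
    (bound := fun t : ℝ => t ^ α.re * Real.exp (-(w.re / 2) * t)) hs
    (Filter.Eventually.of_forall fun z => Measurable.aestronglyMeasurable (by fun_prop))
    (integrableOn_cpow_mul_exp_neg_mul hα hw) (Measurable.aestronglyMeasurable (by fun_prop))
    ?_ (integrableOn_rpow_mul_exp_neg_mul (by linarith) (by linarith)) ?_).2.differentiableAt
  · filter_upwards [ae_restrict_mem measurableSet_Ioi] with t ht z hz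
    have ht' : (0 : ℝ) < t := ht
    rw [← mul_assoc, norm_mul, norm_cpow_mul_exp_neg ht, norm_neg, Complex.norm_real,
      Real.norm_of_nonneg ht'.le]
    have h1 : t ^ (α.re - 1) * t = t ^ α.re := by
      rw [← Real.rpow_add_one ht'.ne']; simp
    have h2 : Real.exp (-z.re * t) ≤ Real.exp (-(w.re / 2) * t) := by
      apply Real.exp_le_exp.mpr
      have : w.re / 2 < z.re := hz
      nlinarith
    calc _ = t ^ (α.re - 1) * t * Real.exp (-z.re * t) := by ring
      _ ≤ _ := by rw [h1]; gcongr
  · refine Filter.Eventually.of_forall fun t z _ => ?_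
    have := ((((hasDerivAt_id z).mul_const (t : ℂ)).neg).cexp).const_mul ((t : ℂ) ^ (α - 1))
    simpa using this

/-- The Laplace transform of `t ^ (α - 1)` on the right half-plane. -/
lemma integral_cpow_mul_exp_neg_mul_of_re_pos {α w : ℂ} (hα : 0 < α.re) (hw : 0 < w.re) :
    ∫ t in Ioi (0 : ℝ), (t : ℂ) ^ (α - 1) * Complex.exp (-(w * t)) =
      w ^ (-α) * Complex.Gamma α := by
  have hU : IsOpen {z : ℂ | 0 < z.re} := isOpen_lt continuous_const Complex.continuous_re
  have hf : AnalyticOnNhd ℂ (fun z : ℂ => ∫ t in Ioi (0 : ℝ), (t : ℂ) ^ (α - 1) *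
      Complex.exp (-(z * t))) {z : ℂ | 0 < z.re} :=
    DifferentiableOn.analyticOnNhd (fun z hz =>
      (differentiableAt_integral_cpow_mul_exp_neg_mul hα hz).differentiableWithinAt) hU
  have hg : AnalyticOnNhd ℂ (fun z : ℂ => z ^ (-α) * Complex.Gamma α) {z : ℂ | 0 < z.re} :=
    DifferentiableOn.analyticOnNhd (fun z hz =>
      ((differentiableAt_id.cpow_const (Or.inl hz)).mul_const _).differentiableWithinAt) hU
  -- Identity theorem: the known formula for real `w > 0` gives agreement at points accumulating at
  -- `1`.
  refine hf.eqOn_of_preconnected_of_frequently_eq hg (convex_halfSpace_re_gt 0).isPreconnected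
    (z₀ := 1) (by simp) ?_ hw
  have ht : Filter.Tendsto (fun x : ℝ => (x : ℂ)) (nhdsWithin 1 {1}ᶜ) (nhdsWithin 1 {1}ᶜ) := by
    refine tendsto_nhdsWithin_iff.mpr ⟨?_, ?_⟩
    · exact (Complex.continuous_ofReal.tendsto' 1 1 (by simp)).mono_left nhdsWithin_le_nhds
    · filter_upwards [self_mem_nhdsWithin] with x hx
      simpa using hx
  refine ht.frequently (Filter.Eventually.frequently ?_)
  filter_upwards [mem_nhdsWithin_of_mem_nhds (Ioi_mem_nhds (one_pos : (0 : ℝ) < 1))] with x hx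
  have hx' : (0 : ℝ) < x := hx
  rw [Complex.integral_cpow_mul_exp_neg_mul_Ioi hα hx', one_div, Complex.inv_cpow,
    Complex.cpow_neg]
  rw [Complex.arg_ofReal_of_nonneg hx'.le]
  exact Real.pi_pos.ne

lemma image_exp_neg_Ioi : (fun t : ℝ => Real.exp (-t)) '' Ioi 0 = Ioo 0 1 := by
  ext u
  simp only [mem_image, mem_Ioi, mem_Ioo]
  constructor
  · rintro ⟨t, ht, rfl⟩
    exact ⟨Real.exp_pos _, by simpa using ht⟩
  · rintro ⟨h0, h1⟩
    exact ⟨-Real.log u, by simpa using Real.log_neg h0 h1, by simp [Real.exp_log h0]⟩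

lemma hasDerivWithinAt_exp_neg (t : ℝ) (s : Set ℝ) :
    HasDerivWithinAt (fun t : ℝ => Real.exp (-t)) (-Real.exp (-t)) s t := by
  simpa using ((hasDerivAt_neg t).exp).hasDerivWithinAt

lemma injOn_exp_neg (s : Set ℝ) : InjOn (fun t : ℝ => Real.exp (-t)) s := by
  intro a _ b _ h
  simpa using h

/-- The substitution `u = e^{-t}` turns the Mellin integral into a Laplace integral; the Jacobian
`e^{-t}` accounts for the shift from `w` to `1 + w`. -/
lemma holder_integrand_subst (α w : ℂ) (t : ℝ) :
    |(-Real.exp (-t))| • ((Complex.Gamma α)⁻¹ * ((Real.log (1 / Real.exp (-t)) : ℝ) : ℂ) ^ (α - 1) *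
      (Real.exp (-t) : ℂ) ^ w) =
      (Complex.Gamma α)⁻¹ * ((t : ℂ) ^ (α - 1) * Complex.exp (-((1 + w) * t))) := by
  have e1 : Real.log (1 / Real.exp (-t)) = t := by
    rw [one_div, ← Real.exp_neg, neg_neg, Real.log_exp]
  have e2 : ((Real.exp (-t) : ℝ) : ℂ) ^ w = Complex.exp (-(w * t)) := by
    rw [Complex.cpow_def_of_ne_zero (by exact_mod_cast (Real.exp_pos _).ne'), ← Complex.ofReal_log
      (Real.exp_pos _).le, Real.log_exp]
    push_cast
    ring_nf
  have e3 : Complex.exp (-((1 + w) * t)) = Complex.exp (-t) * Complex.exp (-(w * t)) := by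
    rw [← Complex.exp_add]; ring_nf
  rw [e1, e2, e3, abs_neg, abs_of_pos (Real.exp_pos _), Complex.real_smul]
  push_cast
  ring

lemma holderKernel_mul_cpow_eq (α w : ℂ) : (fun u : ℝ => holderKernel α u * (u : ℂ) ^ w) =
    (Ioo (0 : ℝ) 1).indicator fun u => (Complex.Gamma α)⁻¹ *
      ((Real.log (1 / u) : ℝ) : ℂ) ^ (α - 1) * (u : ℂ) ^ w := by
  ext u
  by_cases hu : u ∈ Ioo (0 : ℝ) 1 <;> simp [holderKernel, hu]

lemma integrable_holderKernel_mul_cpow {α w : ℂ} (hα : 0 < α.re) (hw : -1 < w.re) :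
    Integrable (fun u : ℝ => holderKernel α u * (u : ℂ) ^ w) := by
  rw [holderKernel_mul_cpow_eq, integrable_indicator_iff measurableSet_Ioo, ← image_exp_neg_Ioi,
    integrableOn_image_iff_integrableOn_abs_deriv_smul measurableSet_Ioi
      (fun t _ => hasDerivWithinAt_exp_neg t _) (injOn_exp_neg _)]
  simp only [holder_integrand_subst]
  exact (integrableOn_cpow_mul_exp_neg_mul hα (by simp; linarith)).const_mul _

/-- The symbol of the Hölder mean: its kernel has Mellin transform `(1 + w) ^ (-α)`. -/
lemma integral_holderKernel_mul_cpow {α w : ℂ} (hα : 0 < α.re) (hw : -1 < w.re) :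
    ∫ u : ℝ, holderKernel α u * (u : ℂ) ^ w = (1 + w) ^ (-α) := by
  rw [holderKernel_mul_cpow_eq, integral_indicator measurableSet_Ioo, ← image_exp_neg_Ioi,
    integral_image_eq_integral_abs_deriv_smul measurableSet_Ioi
      (fun t _ => hasDerivWithinAt_exp_neg t _) (injOn_exp_neg _)]
  simp only [holder_integrand_subst]
  rw [integral_const_mul, integral_cpow_mul_exp_neg_mul_of_re_pos hα (by simp; linarith), mul_comm,
    mul_assoc, mul_inv_cancel₀ (Complex.Gamma_ne_zero_of_re_pos hα), mul_one]

/-! ### Approximate eigenvectors -/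

/-- The power function `x ^ w` truncated to `(0,1)`. -/
noncomputable def truncPow (w : ℂ) : ℝ → ℂ := (Ioo (0 : ℝ) 1).indicator fun x => (x : ℂ) ^ w

lemma truncPow_measurable (w : ℂ) : Measurable (truncPow w) :=
  Measurable.indicator (by fun_prop) measurableSet_Ioo

lemma norm_truncPow_sq (w : ℂ) : (fun x => ‖truncPow w x‖ ^ 2) =
    (Ioo (0 : ℝ) 1).indicator fun x => x ^ (2 * w.re) := by
  ext x
  by_cases hx : x ∈ Ioo (0 : ℝ) 1
  · simp only [truncPow, hx, indicator_of_mem]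
    rw [Complex.norm_cpow_eq_rpow_re_of_pos hx.1, ← Real.rpow_natCast, ← Real.rpow_mul hx.1.le]
    push_cast
    ring_nf
  · simp [truncPow, hx]

lemma truncPow_memLp {w : ℂ} (hw : -1 / 2 < w.re) : MemLp (truncPow w) 2 := by
  rw [memLp_two_iff_integrable_sq_norm (truncPow_measurable w).aestronglyMeasurable,
    norm_truncPow_sq, integrable_indicator_iff measurableSet_Ioo,
    ← intervalIntegrable_iff_integrableOn_Ioo_of_le zero_le_one]
  exact intervalIntegral.intervalIntegrable_rpow' (by linarith)

lemma L2R_norm_sq_toLp {f : ℝ → ℂ} (hf : MemLp f 2) : ‖hf.toLp f‖ ^ 2 = ∫ x, ‖f x‖ ^ 2 := by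
  have h := L2.inner_def (𝕜 := ℂ) (hf.toLp f) (hf.toLp f)
  rw [inner_self_eq_norm_sq_to_K] at h
  have h2 : ∫ x, inner ℂ ((hf.toLp f) x) ((hf.toLp f) x) = ((∫ x, ‖f x‖ ^ 2 : ℝ) : ℂ) := by
    rw [← integral_complex_ofReal]
    apply integral_congr_ae
    filter_upwards [hf.coeFn_toLp] with x hx
    rw [hx, inner_self_eq_norm_sq_to_K]
    simp
  rw [h2] at h
  exact Complex.ofReal_injective (by simpa using h)

/-- The norm blows up as `Re w → -1/2`, so after normalization any bounded error becomes negligible.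
-/
lemma norm_sq_truncPow {w : ℂ} (hw : -1 / 2 < w.re) :
    ‖(truncPow_memLp hw).toLp (truncPow w)‖ ^ 2 = (2 * w.re + 1)⁻¹ := by
  rw [L2R_norm_sq_toLp, norm_truncPow_sq, integral_indicator measurableSet_Ioo,
    ← integral_Ioc_eq_integral_Ioo, ← intervalIntegral.integral_of_le zero_le_one,
    integral_rpow (Or.inl (by linarith)), Real.one_rpow, Real.zero_rpow (by linarith)]
  simp

/-- For `0 < x < 1` the averaging only sees points `u * x < 1`, where the truncation is invisible
and `(ux)^w = u^w x^w`. For `x ≤ 0` both sides vanish. -/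
lemma hausdorffFun_holder_truncPow_of_lt {α w : ℂ} (hα : 0 < α.re) (hw : -1 < w.re) {x : ℝ}
    (hx : x < 1) :
    hausdorffFun (holderKernel α) (truncPow w) x = (1 + w) ^ (-α) * truncPow w x := by
  rw [← integral_holderKernel_mul_cpow hα hw, hausdorffFun, ← integral_mul_const]
  congr 1
  ext u
  by_cases hu : u ∈ Ioo (0 : ℝ) 1
  · by_cases h0 : 0 < x
    · have h1 : u * x ∈ Ioo (0 : ℝ) 1 := ⟨mul_pos hu.1 h0, by nlinarith [hu.1, hu.2]⟩
      have h2 : x ∈ Ioo (0 : ℝ) 1 := ⟨h0, hx⟩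
      simp only [truncPow, h1, h2, indicator_of_mem]
      rw [Complex.ofReal_mul, Complex.mul_cpow_ofReal_nonneg hu.1.le h0.le]
      ring
    · have h1 : u * x ∉ Ioo (0 : ℝ) 1 := fun h => h0 (pos_of_mul_pos_right h.1 hu.1.le)
      have h2 : x ∉ Ioo (0 : ℝ) 1 := fun h => h0 h.1
      simp [truncPow, h1, h2]
  · simp [holderKernel, hu]

/-- On `(0,1)` the truncated power is dominated by `y ^ (-3/4)`, uniformly in `w`. Any exponent
strictly between `-1` and `-1/2` would serve: above `-1` the kernel integral converges, below `-1/2`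
the tail is square-integrable on `[1, ∞)`. -/
lemma norm_hausdorffFun_holder_truncPow_le {α w : ℂ} (hα : 0 < α.re) (hw : -3 / 4 ≤ w.re) {x : ℝ}
    (hx : 1 ≤ x) :
    ‖hausdorffFun (holderKernel α) (truncPow w) x‖ ≤
      (∫ u : ℝ, ‖holderKernel α u * (u : ℂ) ^ (-3 / 4 : ℂ)‖) * x ^ (-3 / 4 : ℝ) := by
  have hre : (-3 / 4 : ℂ).re = -3 / 4 := by norm_num
  have h0 : 0 < x := by linarith
  rw [← integral_mul_const]
  refine norm_integral_le_of_norm_le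
    ((integrable_holderKernel_mul_cpow hα (by rw [hre]; norm_num)).norm.mul_const _)
    (Filter.Eventually.of_forall fun u => ?_)
  by_cases hu : u ∈ Ioo (0 : ℝ) 1
  · rw [norm_mul, norm_mul, mul_assoc]
    gcongr
    rw [Complex.norm_cpow_eq_rpow_re_of_pos hu.1, hre, ← Real.mul_rpow hu.1.le h0.le]
    by_cases h1 : u * x ∈ Ioo (0 : ℝ) 1
    · simp only [truncPow, h1, indicator_of_mem]
      rw [Complex.norm_cpow_eq_rpow_re_of_pos h1.1]
      exact Real.rpow_le_rpow_of_exponent_ge h1.1 h1.2.le hw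
    · simp only [truncPow, h1, not_false_iff, indicator_of_notMem, norm_zero]
      exact Real.rpow_nonneg (mul_pos hu.1 h0).le _
  · simp [holderKernel, hu]

lemma memLp_indicator_Ici_rpow :
    MemLp ((Ici (1 : ℝ)).indicator fun x => x ^ (-3 / 4 : ℝ)) 2 := by
  rw [memLp_two_iff_integrable_sq
    (Measurable.aestronglyMeasurable (Measurable.indicator (by fun_prop) measurableSet_Ici))]
  have h : IntegrableOn (fun x : ℝ => x ^ (-3 / 2 : ℝ)) (Ici 1) :=
    (integrableOn_Ici_iff_integrableOn_Ioi).mpr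
      (integrableOn_Ioi_rpow_of_lt (by norm_num) one_pos)
  rw [← integrable_indicator_iff measurableSet_Ici] at h
  refine h.congr (Filter.Eventually.of_forall fun x => ?_)
  by_cases hx : x ∈ Ici (1 : ℝ)
  · have : (0 : ℝ) < x := one_pos.trans_le hx
    simp only [hx, indicator_of_mem]
    rw [← Real.rpow_natCast, ← Real.rpow_mul this.le]
    norm_num
  · simp [hx]

/-- Truncated powers are eigenvectors of the Hölder means up to a uniformly bounded error. -/
lemma exists_norm_holderOp_truncPow_sub_le {α : ℂ} (hα : 0 < α.re) :
    ∃ M : ℝ, ∀ (w : ℂ) (hw : -1 / 2 < w.re),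
      ‖holderOp α ((truncPow_memLp hw).toLp _) -
        (1 + w) ^ (-α) • (truncPow_memLp hw).toLp (truncPow w)‖ ≤ M := by
  set B := ∫ u : ℝ, ‖holderKernel α u * (u : ℂ) ^ (-3 / 4 : ℂ)‖ with hB
  have hB0 : 0 ≤ B := integral_nonneg fun u => norm_nonneg _
  refine ⟨B * ‖memLp_indicator_Ici_rpow.toLp _‖, fun w hw => ?_⟩
  set f := (truncPow_memLp hw).toLp (truncPow w) with hf
  apply Lp.norm_le_mul_norm_of_ae_le_mul
  rw [holderOp, dif_pos hα]
  filter_upwards [Lp.coeFn_sub (hausdorffOp (holderKernel α) (holderKernel_hausdorffKernel hα) f)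
      ((1 + w) ^ (-α) • f), Lp.coeFn_smul ((1 + w) ^ (-α)) f,
    hausdorffOp_coeFn (holderKernel_hausdorffKernel hα) f, (truncPow_memLp hw).coeFn_toLp,
    memLp_indicator_Ici_rpow.coeFn_toLp, Measure.ae_ne volume (0 : ℝ)] with x h1 h2 h3 h4 h5 hx0
  have h6 : hausdorffFun (holderKernel α) f x = hausdorffFun (holderKernel α) (truncPow w) x := by
    apply integral_congr_ae
    filter_upwards [ae_dilate (truncPow_memLp hw).coeFn_toLp hx0] with u hu
    rw [hu]
  rw [h1, Pi.sub_apply, h2, Pi.smul_apply, h3, h4, h5, h6, smul_eq_mul]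
  rcases lt_or_ge x 1 with hx | hx
  · rw [hausdorffFun_holder_truncPow_of_lt hα (by linarith) hx, sub_self, norm_zero]
    positivity
  · have h7 : x ∉ Ioo (0 : ℝ) 1 := fun h => absurd h.2 (not_lt.mpr hx)
    have h8 : x ∈ Ici (1 : ℝ) := hx
    have h9 : truncPow w x = 0 := by simp [truncPow, h7]
    rw [h9, mul_zero, sub_zero, indicator_of_mem h8, Real.norm_of_nonneg (by positivity)]
    exact norm_hausdorffFun_holder_truncPow_le hα (by linarith) hx

/-- Common approximate eigenvectors of all Hölder means. -/
lemma exists_approx_eigenvector (s : ℝ) : ∃ g : ℕ → L2R, (∀ n, ‖g n‖ = 1) ∧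
    ∀ α : ℂ, 0 < α.re → Filter.Tendsto
      (fun n => holderOp α (g n) - (1 / 2 + s * Complex.I : ℂ) ^ (-α) • g n) Filter.atTop
      (nhds 0) := by
  -- Approaches `-1/2 + is` from the right; the truncated powers then have squared norm `(n + 1) /
  -- 2`.
  set w : ℕ → ℂ := fun n => ((-1 / 2 + 1 / ((n : ℝ) + 1) : ℝ) : ℂ) + s * Complex.I with hwdef
  have hre : ∀ n, (w n).re = -1 / 2 + 1 / ((n : ℝ) + 1) := by
    intro n
    rw [hwdef, Complex.add_re, Complex.ofReal_re]
    simp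
  have hw : ∀ n, -1 / 2 < (w n).re := by
    intro n; rw [hre]
    have : 0 < 1 / ((n : ℝ) + 1) := by positivity
    linarith
  set f : ℕ → L2R := fun n => (truncPow_memLp (hw n)).toLp (truncPow (w n)) with hfdef
  have hnorm : ∀ n, ‖f n‖⁻¹ ^ 2 = 2 * (1 / ((n : ℝ) + 1)) := by
    intro n
    rw [inv_pow, hfdef, norm_sq_truncPow (hw n), inv_inv, hre]
    ring
  have hlim0 : Filter.Tendsto (fun n : ℕ => 1 / ((n : ℝ) + 1)) Filter.atTop (nhds 0) :=
    tendsto_one_div_add_atTop_nhds_zero_nat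
  have hinv : Filter.Tendsto (fun n => ‖f n‖⁻¹) Filter.atTop (nhds 0) := by
    have h := (hlim0.const_mul 2).sqrt
    simp only [mul_zero, Real.sqrt_zero] at h
    refine h.congr fun n => ?_
    rw [← hnorm, Real.sqrt_sq (by positivity)]
  have hne : ∀ n, ‖f n‖ ≠ 0 := by
    intro n h
    have := hnorm n
    rw [h] at this
    have h2 : 0 < 2 * (1 / ((n : ℝ) + 1)) := by positivity
    simp at this
    norm_cast at this
  have hwlim : Filter.Tendsto (fun n => 1 + w n) Filter.atTop (nhds (1 / 2 + s * Complex.I)) := by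
    have h := ((Complex.continuous_ofReal.tendsto _).comp
      (hlim0.const_add (-1 / 2 : ℝ))).add_const (s * Complex.I : ℂ) |>.const_add (1 : ℂ)
    convert h using 2
    · simp only [hwdef, Function.comp_apply]
    · push_cast
      ring
  refine ⟨fun n => ((‖f n‖⁻¹ : ℝ) : ℂ) • f n, fun n => ?_, fun α hα => ?_⟩
  · rw [norm_smul, Complex.norm_real, norm_inv, norm_norm, inv_mul_cancel₀ (hne n)]
  · obtain ⟨M, hM⟩ := exists_norm_holderOp_truncPow_sub_le hα
    have hpow : Filter.Tendsto (fun n => ‖(1 + w n) ^ (-α) - (1 / 2 + s * Complex.I : ℂ) ^ (-α)‖)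
        Filter.atTop (nhds 0) := by
      have hc : ContinuousAt (fun z : ℂ => z ^ (-α)) (1 / 2 + s * Complex.I) :=
        (differentiableAt_id.cpow_const (Or.inl (by simp))).continuousAt
      have := ((hc.tendsto.comp hwlim).sub_const ((1 / 2 + s * Complex.I : ℂ) ^ (-α))).norm
      simpa using this
    refine squeeze_zero_norm (a := fun n => ‖f n‖⁻¹ * M +
      ‖(1 + w n) ^ (-α) - (1 / 2 + s * Complex.I : ℂ) ^ (-α)‖) (fun n => ?_) ?_
    -- The truncation error divided by the growing norm, plus the variation of the symbol.
    · have e : holderOp α (((‖f n‖⁻¹ : ℝ) : ℂ) • f n) -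
          (1 / 2 + s * Complex.I : ℂ) ^ (-α) • ((‖f n‖⁻¹ : ℝ) : ℂ) • f n =
          ((‖f n‖⁻¹ : ℝ) : ℂ) • (holderOp α (f n) - (1 + w n) ^ (-α) • f n) +
          ((1 + w n) ^ (-α) - (1 / 2 + s * Complex.I : ℂ) ^ (-α)) •
            ((‖f n‖⁻¹ : ℝ) : ℂ) • f n := by
        rw [map_smul, smul_sub, sub_smul, smul_comm ((‖f n‖⁻¹ : ℝ) : ℂ) ((1 + w n) ^ (-α))]
        abel
      rw [e]
      refine (norm_add_le _ _).trans (add_le_add ?_ ?_)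
      · rw [norm_smul, Complex.norm_real, norm_inv, norm_norm]
        gcongr
        exact hM (w n) (hw n)
      · rw [norm_smul, norm_smul ((‖f n‖⁻¹ : ℝ) : ℂ), Complex.norm_real, norm_inv, norm_norm,
          inv_mul_cancel₀ (hne n), mul_one]
    · simpa using (hinv.mul_const M).add hpow

/-! ### Spectral points of `C` and values of `F` there -/

lemma half_add_mul_I_ne_zero (s : ℝ) : (1 / 2 + s * Complex.I : ℂ) ≠ 0 := by
  intro h
  have := congrArg Complex.re h
  simp at this

lemma exists_cesaro_approx_eigenvector (s : ℝ) : ∃ g : ℕ → L2R, (∀ n, ‖g n‖ = 1) ∧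
    Filter.Tendsto (fun n => (cesaroOp - algebraMap ℂ (L2R →L[ℂ] L2R)
      (1 / 2 + s * Complex.I : ℂ)⁻¹) (g n)) Filter.atTop (nhds 0) ∧
    ∀ α : ℂ, 0 < α.re → Filter.Tendsto
      (fun n => holderOp α (g n) - (1 / 2 + s * Complex.I : ℂ) ^ (-α) • g n) Filter.atTop
      (nhds 0) := by
  obtain ⟨g, hg, h⟩ := exists_approx_eigenvector s
  refine ⟨g, hg, ?_, h⟩
  have h1 := h 1 (by simp)
  rw [holderOp_one, Complex.cpow_neg_one] at h1
  exact h1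

/-- A bounded resolvent at this point would send `(C - z) g n → 0` to `-g n`, which has norm `1`. -/
lemma inv_mem_spectrum_cesaroOp (s : ℝ) :
    (1 / 2 + s * Complex.I : ℂ)⁻¹ ∈ spectrum ℂ cesaroOp := by
  by_contra hz
  obtain ⟨g, hg, h, -⟩ := exists_cesaro_approx_eigenvector s
  set z := (1 / 2 + s * Complex.I : ℂ)⁻¹
  have hres := resolvent_mul_algebraMap_sub (mem_resolventSet_of_notMem hz)
  have h1 := (((resolvent cesaroOp z).continuous.tendsto' 0 0 (map_zero _)).comp h).norm
  have h2 : ∀ n, resolvent cesaroOp z ((cesaroOp - algebraMap ℂ (L2R →L[ℂ] L2R) z) (g n)) =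
      -g n := by
    intro n
    rw [← neg_sub, neg_apply, map_neg, ← mul_apply_eq_comp, hres,
      one_apply_eq_self]
  simp only [Function.comp_def, h2, norm_neg, hg, norm_zero] at h1
  exact one_ne_zero (tendsto_nhds_unique tendsto_const_nhds h1)

lemma norm_half_add_mul_I_atTop :
    Filter.Tendsto (fun s : ℝ => ‖(1 / 2 + s * Complex.I : ℂ)‖) Filter.atTop Filter.atTop := by
  refine Filter.tendsto_atTop_mono (fun s => ?_) Filter.tendsto_id
  have := Complex.abs_im_le_norm (1 / 2 + s * Complex.I : ℂ)
  simp at this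
  exact (le_abs_self s).trans (by simpa using this)

lemma tendsto_half_add_mul_I_inv :
    Filter.Tendsto (fun s : ℝ => (1 / 2 + s * Complex.I : ℂ)⁻¹) Filter.atTop (nhds 0) := by
  rw [tendsto_zero_iff_norm_tendsto_zero]
  simp only [norm_inv]
  exact norm_half_add_mul_I_atTop.inv_tendsto_atTop

/-- A limit, as `s → ∞`, of spectral points. This is what forces `F` to be holomorphic at `0`, the
branch point of `z ^ α`. -/
lemma zero_mem_spectrum_cesaroOp : (0 : ℂ) ∈ spectrum ℂ cesaroOp :=
  (spectrum.isClosed cesaroOp).mem_of_tendsto tendsto_half_add_mul_I_inv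
    (Filter.Eventually.of_forall fun s => inv_mem_spectrum_cesaroOp s)

/-- If `H_α = F(C)`, then `F` is the symbol `z ↦ z ^ α` on the spectrum. -/
lemma IsHolomorphicCalculus.apply_inv_eq {F : ℂ → ℂ} {α : ℂ} (hα : 0 < α.re)
    (h : IsHolomorphicCalculus F (holderOp α)) (s : ℝ) :
    F (1 / 2 + s * Complex.I : ℂ)⁻¹ = (1 / 2 + s * Complex.I : ℂ) ^ (-α) := by
  obtain ⟨U, hU, -, hF, r, R, hr, -, hspec, hsub, heq⟩ := h
  obtain ⟨hw1, hw2⟩ := hspec (inv_mem_spectrum_cesaroOp s)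
  obtain ⟨g, hg, hC, hH⟩ := exists_cesaro_approx_eigenvector s
  set w := (1 / 2 + s * Complex.I : ℂ)⁻¹
  set μ := (1 / 2 + s * Complex.I : ℂ) ^ (-α)
  obtain ⟨Q, hQ⟩ := exists_annulus_integral_eq (a := cesaroOp) hU hF hr (c := 1) (R := R)
    (fun z hz => hsub ⟨not_lt.mp fun h => hz.2 (mem_ball_iff_norm.mpr h),
      mem_closedBall_iff_norm.mp hz.1⟩) (fun z hz => hspec hz) hw1 hw2
  have hQ' : holderOp α = F w • 1 + Q * (cesaroOp - algebraMap ℂ (L2R →L[ℂ] L2R) w) :=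
    heq.trans hQ
  -- On `g n` the term `Q (C - w)` tends to `0`, so the constants `F w` and `μ` must coincide.
  have h1 := (hH α hα).sub ((Q.continuous.tendsto' 0 0 (map_zero _)).comp hC)
  have h2 : ∀ n, holderOp α (g n) - μ • g n -
      Q ((cesaroOp - algebraMap ℂ (L2R →L[ℂ] L2R) w) (g n)) = (F w - μ) • g n := by
    intro n
    rw [hQ', add_apply, smul_apply,
      one_apply_eq_self, mul_apply_eq_comp, sub_smul]
    abel
  have h3 := (h1.congr h2).norm
  simp only [norm_smul, hg, mul_one, sub_zero, norm_zero] at h3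
  exact sub_eq_zero.mp (norm_eq_zero.mp (tendsto_nhds_unique tendsto_const_nhds h3))

lemma IsHolomorphicCalculus.analyticAt_zero {F : ℂ → ℂ} {B : L2R →L[ℂ] L2R}
    (h : IsHolomorphicCalculus F B) : AnalyticAt ℂ F 0 := by
  obtain ⟨U, hU, hsU, hF, -⟩ := h
  exact hF.analyticAt (hU.mem_nhds (hsU zero_mem_spectrum_cesaroOp))

/-! ### Analyticity at `0` forces an integer exponent -/

lemma tendsto_arg_half_add_mul_I :
    Filter.Tendsto (fun s : ℝ => (1 / 2 + s * Complex.I : ℂ).arg) Filter.atTop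
      (nhds (Real.pi / 2)) := by
  -- Dividing by `s > 0` preserves the argument and makes the point converge to `I`.
  have h1 : Filter.Tendsto (fun s : ℝ => ((s⁻¹ : ℝ) : ℂ) * (1 / 2) + Complex.I) Filter.atTop
      (nhds Complex.I) := by
    have := (((Complex.continuous_ofReal.tendsto' 0 0 (by simp)).comp
      tendsto_inv_atTop_zero).mul_const (1 / 2 : ℂ)).add_const Complex.I
    rwa [zero_mul, zero_add] at this
  have h2 := (Complex.continuousAt_arg (x := Complex.I) (by simp [Complex.mem_slitPlane_iff])).tendsto.comp h1
  rw [Complex.arg_I] at h2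
  refine h2.congr' ?_
  filter_upwards [Filter.eventually_gt_atTop 0] with s hs
  rw [Function.comp_apply, ← Complex.arg_real_mul _ hs]
  congr 1
  have : (s : ℂ) ≠ 0 := by exact_mod_cast hs.ne'
  push_cast
  field_simp

lemma half_add_neg_mul_I (s : ℝ) :
    (1 / 2 + ((-s : ℝ) : ℂ) * Complex.I : ℂ) = (starRingEnd ℂ) (1 / 2 + s * Complex.I) := by
  apply Complex.ext <;> simp

/-- A function that is analytic at `0` and equals `z ^ α` along the circle `|z - 1| = 1` forces `α`
to be a nonnegative integer. -/
lemma exists_nat_eq_of_analyticAt {F : ℂ → ℂ} {α : ℂ} (hF : AnalyticAt ℂ F 0)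
    (h : ∀ s : ℝ, F (1 / 2 + s * Complex.I : ℂ)⁻¹ = (1 / 2 + s * Complex.I : ℂ) ^ (-α)) :
    ∃ n : ℕ, α = n := by
  have hneg : Filter.Tendsto (fun s : ℝ => (1 / 2 + ((-s : ℝ) : ℂ) * Complex.I : ℂ)⁻¹) Filter.atTop
      (nhds 0) := by
    simp only [half_add_neg_mul_I, ← map_inv₀]
    exact (Complex.continuous_conj.tendsto' 0 0 (by simp)).comp tendsto_half_add_mul_I_inv
  -- `F` has finite order at `0`, since `p ^ (-α)` never vanishes.
  have hnz : ¬ ∀ᶠ z in nhds 0, F z = 0 := by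
    intro h0
    obtain ⟨s, hs⟩ := (tendsto_half_add_mul_I_inv.eventually h0).exists
    rw [h] at hs
    exact half_add_mul_I_ne_zero s ((Complex.cpow_eq_zero_iff _ _).mp hs).1
  obtain ⟨n, g, hg, hg0, hFg⟩ := hF.exists_eventuallyEq_pow_smul_nonzero_iff.mpr hnz
  have key : ∀ s : ℝ, F (1 / 2 + s * Complex.I : ℂ)⁻¹ =
      ((1 / 2 + s * Complex.I : ℂ)⁻¹ - 0) ^ n • g (1 / 2 + s * Complex.I : ℂ)⁻¹ →
      ‖g (1 / 2 + s * Complex.I : ℂ)⁻¹‖ = ‖(1 / 2 + s * Complex.I : ℂ)‖ ^ (n - α.re) *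
        Real.exp ((1 / 2 + s * Complex.I : ℂ).arg * α.im) := by
    intro s hs
    have hp := half_add_mul_I_ne_zero s
    have hp' := norm_pos_iff.mpr hp
    rw [h, sub_zero, smul_eq_mul, inv_pow] at hs
    have h1 := congrArg norm hs
    rw [norm_mul, norm_inv, norm_pow, Complex.norm_cpow_of_ne_zero hp] at h1
    rw [eq_inv_mul_iff_mul_eq₀ (pow_pos hp' n).ne'] at h1
    rw [← h1, Real.rpow_sub hp', Real.rpow_natCast, Complex.neg_re, Real.rpow_neg hp'.le,
      Complex.neg_im, mul_neg, Real.exp_neg, div_inv_eq_mul]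
    ring
  have k1 : ∀ᶠ s : ℝ in Filter.atTop, ‖g (1 / 2 + s * Complex.I : ℂ)⁻¹‖ =
      ‖(1 / 2 + s * Complex.I : ℂ)‖ ^ (n - α.re) *
        Real.exp ((1 / 2 + s * Complex.I : ℂ).arg * α.im) := by
    filter_upwards [tendsto_half_add_mul_I_inv.eventually hFg] with s hs using key s hs
  -- Replacing `s` by `-s` conjugates `p`: the modulus stays and the argument changes sign.
  have k2 : ∀ᶠ s : ℝ in Filter.atTop, ‖g (1 / 2 + ((-s : ℝ) : ℂ) * Complex.I : ℂ)⁻¹‖ =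
      ‖(1 / 2 + s * Complex.I : ℂ)‖ ^ (n - α.re) *
        Real.exp (-(1 / 2 + s * Complex.I : ℂ).arg * α.im) := by
    filter_upwards [hneg.eventually hFg] with s hs
    rw [key (-s) hs, half_add_neg_mul_I, Complex.norm_conj, Complex.arg_conj, if_neg]
    intro h1
    have := (Complex.arg_eq_pi_iff.mp h1).1
    simp at this
    linarith
  have l1 := (hg.continuousAt.tendsto.comp tendsto_half_add_mul_I_inv).norm
  have l2 := (hg.continuousAt.tendsto.comp hneg).norm
  have hg0' : ‖g 0‖ ≠ 0 := norm_ne_zero_iff.mpr hg0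
  have him : α.im = 0 := by
    -- The quotient of the two moduli tends to `1`, both having limit `‖g 0‖`. The powers of `‖p‖`
    -- cancel, leaving `exp (2 * arg p * Im α)`, which tends to `exp (π * Im α)`.
    have l3 := l1.div l2 hg0'
    rw [div_self hg0'] at l3
    have l4 : Filter.Tendsto (fun s : ℝ => Real.exp (2 * (1 / 2 + s * Complex.I : ℂ).arg * α.im))
        Filter.atTop (nhds 1) := by
      refine l3.congr' ?_
      filter_upwards [k1, k2] with s h1 h2
      simp only [Function.comp_apply, h1, h2, Pi.div_apply]
      rw [mul_div_mul_left _ _ (Real.rpow_pos_of_pos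
        (norm_pos_iff.mpr (half_add_mul_I_ne_zero s)) _).ne', ← Real.exp_sub]
      ring_nf
    have l5 := (Real.continuous_exp.tendsto _).comp
      ((tendsto_arg_half_add_mul_I.const_mul 2).mul_const α.im)
    have l6 := tendsto_nhds_unique l5 l4
    rw [Real.exp_eq_one_iff] at l6
    have := Real.pi_ne_zero
    rcases mul_eq_zero.mp l6 with h1 | h1
    · exact absurd h1 (by positivity)
    · exact h1
  have hre : (n : ℝ) - α.re = 0 := by
    have l3 : Filter.Tendsto (fun s : ℝ => ‖(1 / 2 + s * Complex.I : ℂ)‖ ^ (n - α.re))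
        Filter.atTop (nhds ‖g 0‖) := by
      refine l1.congr' ?_
      filter_upwards [k1] with s h1
      rw [Function.comp_apply, h1, him, mul_zero, Real.exp_zero, mul_one]
    -- As `‖p‖ → ∞`, a negative exponent would give limit `0` and a positive one divergence; the
    -- limit is `‖g 0‖ ≠ 0`.
    rcases lt_trichotomy ((n : ℝ) - α.re) 0 with h1 | h1 | h1
    · have l4 := (tendsto_rpow_neg_atTop (neg_pos.mpr h1)).comp norm_half_add_mul_I_atTop
      simp only [neg_neg, Function.comp_def] at l4
      exact absurd (tendsto_nhds_unique l3 l4) hg0'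
    · exact h1
    · have l4 := (tendsto_rpow_atTop h1).comp norm_half_add_mul_I_atTop
      exact absurd l3 (not_tendsto_nhds_of_tendsto_atTop l4 _)
  exact ⟨n, Complex.ext (by simp; linarith) (by simpa using him)⟩

theorem mainTheorem9 (α : ℂ) :
    ((0 < α.re ∨ α = 0) →
      ((∃ F : ℂ → ℂ, IsHolomorphicCalculus F (holderOp α)) ↔ ∃ n : ℕ, α = (n : ℂ))) ∧
    (0 < α.re →
      ((∃ F : ℂ → ℂ, F 0 = 0 ∧ IsHolomorphicCalculus F (holderOp α)) ↔
        ∃ n : ℕ, α = (n : ℂ))) := by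
  refine ⟨fun hα => ⟨?_, ?_⟩, fun hα => ⟨?_, ?_⟩⟩
  · rintro ⟨F, hF⟩
    rcases hα with hα | rfl
    · exact exists_nat_eq_of_analyticAt hF.analyticAt_zero (hF.apply_inv_eq hα)
    · exact ⟨0, by simp⟩
  · rintro ⟨n, rfl⟩
    exact ⟨_, holderOp_natCast n ▸ isHolomorphicCalculus_pow n⟩
  · rintro ⟨F, -, hF⟩
    exact exists_nat_eq_of_analyticAt hF.analyticAt_zero (hF.apply_inv_eq hα)
  · rintro ⟨n, rfl⟩
    refine ⟨fun z => z ^ n, ?_, holderOp_natCast n ▸ isHolomorphicCalculus_pow n⟩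
    -- `Re α > 0` excludes `n = 0`, the one power that does not vanish at `0`.
    have hn : n ≠ 0 := by
      rintro rfl
      simp at hα
    exact zero_pow hn
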